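/- Let $C$ be a smooth connected complete curve over $\mathbb{C}$ and let $L$ be a line bundle on $C$. Let $M$ be a vector bundle of rank $k$ on $C$ with $c_1(M)=c_1(L)$ in $\mathrm{Pic}(C)$ (that is, $\det M\simeq \det L = L$) and $h^0(M^*)=0$. Let $\Pi\subset H^0(M)$ be a subspace of dimension $2k+1$ which generates $M$ (the evaluation map $\Pi\otimes\mathcal{O}_C\to M$ is surjective), and let $\Sigma\subset\Pi$ be a subspace of dimension $k+1$ which also generates $M$. Set $V=\Pi/\Sigma$. Then there exists a vector bundle $E_V$ of rank $k+1$ on $C$ with $h^0(E_V)\ge 2k+1$ and an exact sequence $$0\longrightarrow L^*\longrightarrow E_V^*\longrightarrow V\otimes\mathcal{O}_C\longrightarrow 0.$$ Moreover, $E_V$ and this sequence can be chosen so that $E_V^*$ is the kernel of the evaluation map, i.e. there is an exact sequence $0\to E_V^*\to\Pi\otimes\mathcal{O}_C\to M\to 0$ with second map the evaluation map, and the map $E_V^*\to V\otimes\mathcal{O}_C$ is the composition of $E_V^*\to\Pi\otimes\mathcal{O}_C$ with the map $\Pi\otimes\mathcal{O}_C\to V\otimes\mathcal{O}_C$ induced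 by the projection $\Pi\to V$. -/

import Mathlib

open CategoryTheory Opposite AlgebraicGeometry TopologicalSpace

noncomputable section

namespace CurveBundle

universe u

/-! ### Rank and determinant of a vector bundle -/

section Exterior

variable {R S A B : Type*} [CommRing R] [CommRing S] [AddCommGroup A] [AddCommGroup B]
  [Module R A] [Module S B]

/-- The additive map `⋀ⁿ A → ⋀ⁿ B` induced by an additive map `g : A → B` that is semilinear over
a ring homomorphism `f : R → S`. -/
def exteriorMap (n : ℕ) (f : R →+* S) (g : A →+ B) (hg : ∀ (r : R) (a : A), g (r • a) = f r • g a) :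
    ⋀[R]^n A →+ ⋀[S]^n B :=
  letI : Module R B := Module.compHom B f
  letI : Module R (⋀[S]^n B) := Module.compHom (⋀[S]^n B) f
  (exteriorPower.alternatingMapLinearEquiv (R := R) (n := n)
    { toFun := fun v => exteriorPower.ιMulti S n fun i => g (v i)
      map_update_add' := by
        intro _ v i x y
        have h (z : A) : (fun j => g (Function.update v i z j)) =
            Function.update (fun j => g (v j)) i (g z) := by
          funext j
          by_cases hj : j = i
          · subst hj; simp
          · simp [hj]
        have e := Subsingleton.elim (‹DecidableEq (Fin n)›) (instDecidableEqFin n)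
        subst e
        simp only [h, map_add, AlternatingMap.map_update_add]
      map_update_smul' := by
        intro _ v i r x
        have h (z : A) : (fun j => g (Function.update v i z j)) =
            Function.update (fun j => g (v j)) i (g z) := by
          funext j
          by_cases hj : j = i
          · subst hj; simp
          · simp [hj]
        have e := Subsingleton.elim (‹DecidableEq (Fin n)›) (instDecidableEqFin n)
        subst e
        simp only [h, hg, AlternatingMap.map_update_smul]
        rfl
      map_eq_zero_of_eq' := by
        intro v i j hv hij
        exact AlternatingMap.map_eq_zero_of_eq _ _ (by simp [hv]) hij } :
    ⋀[R]^n A →ₗ[R] ⋀[S]^n B).toAddMonoidHom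

lemma exteriorMap_ιMulti (n : ℕ) (f : R →+* S) (g : A →+ B)
    (hg : ∀ (r : R) (a : A), g (r • a) = f r • g a) (v : Fin n → A) :
    exteriorMap n f g hg (exteriorPower.ιMulti R n v) =
      exteriorPower.ιMulti S n fun i => g (v i) := by
  let _ : Module R B := Module.compHom B f
  let _ : Module R (⋀[S]^n B) := Module.compHom (⋀[S]^n B) f
  exact exteriorPower.alternatingMapLinearEquiv_apply_ιMulti _ v

lemma exteriorMap_smul (n : ℕ) (f : R →+* S) (g : A →+ B)
    (hg : ∀ (r : R) (a : A), g (r • a) = f r • g a) (r : R) (x : ⋀[R]^n A) :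
    exteriorMap n f g hg (r • x) = f r • exteriorMap n f g hg x := by
  let _ : Module R B := Module.compHom B f
  let _ : Module R (⋀[S]^n B) := Module.compHom (⋀[S]^n B) f
  exact map_smul (exteriorPower.alternatingMapLinearEquiv (R := R) (n := n) _) r x

lemma exterior_induction (n : ℕ) {p : ⋀[R]^n A → Prop} (x : ⋀[R]^n A)
    (hι : ∀ v, p (exteriorPower.ιMulti R n v)) (hadd : ∀ x y, p x → p y → p (x + y))
    (hsmul : ∀ (r : R) x, p x → p (r • x)) : p x := by
  have hx : x ∈ Submodule.span R (Set.range (exteriorPower.ιMulti R n (M := A))) := by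
    rw [exteriorPower.ιMulti_span]; trivial
  induction hx using Submodule.span_induction with
  | mem x h => obtain ⟨v, rfl⟩ := h; exact hι v
  | zero => simpa using hsmul 0 _ (hι 0)
  | add x y _ _ hx hy => exact hadd x y hx hy
  | smul r x _ hx => exact hsmul r x hx

lemma exteriorMap_id (n : ℕ) (f : R →+* R) (g : A →+ A)
    (hg : ∀ (r : R) (a : A), g (r • a) = f r • g a) (hf : f = RingHom.id R)
    (h : g = AddMonoidHom.id A) : exteriorMap n f g hg = AddMonoidHom.id _ := by
  subst hf h
  ext1 x
  refine exterior_induction (p := fun x => exteriorMap n (RingHom.id R) (AddMonoidHom.id A) hg x =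
    AddMonoidHom.id _ x) n x (fun v => ?_) (fun x y hx hy => ?_) (fun r x hx => ?_)
  · simp [exteriorMap_ιMulti]
  · rw [map_add, hx, hy, map_add]
  · rw [exteriorMap_smul, hx]; rfl

lemma exteriorMap_comp {T D : Type*} [CommRing T] [AddCommGroup D] [Module T D] (n : ℕ)
    (f : R →+* S) (g : A →+ B) (hg : ∀ (r : R) (a : A), g (r • a) = f r • g a)
    (f' : S →+* T) (g' : B →+ D) (hg' : ∀ (r : S) (b : B), g' (r • b) = f' r • g' b)
    (f'' : R →+* T) (g'' : A →+ D) (hg'' : ∀ (r : R) (a : A), g'' (r • a) = f'' r • g'' a)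
    (hf : f'' = f'.comp f) (h : g'' = g'.comp g) :
    exteriorMap n f'' g'' hg'' = (exteriorMap n f' g' hg').comp (exteriorMap n f g hg) := by
  subst hf h
  ext1 x
  refine exterior_induction (p := fun x => exteriorMap n (f'.comp f) (g'.comp g) hg'' x =
    (exteriorMap n f' g' hg').comp (exteriorMap n f g hg) x) n x
    (fun v => ?_) (fun x y hx hy => ?_) (fun r x hx => ?_)
  · simp [exteriorMap_ιMulti]
  · rw [map_add, hx, hy, map_add]
  · rw [exteriorMap_smul, hx, AddMonoidHom.comp_apply, AddMonoidHom.comp_apply, exteriorMap_smul,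
      exteriorMap_smul]; rfl

end Exterior

variable {X : Scheme.{u}}

/-- `M` is locally free of rank `k`: every point has an open neighbourhood `U` on which `M` has a
frame, i.e. sections `e₁, …, e_k` over `U` whose restrictions to every open `W ⊆ U` form a basis of
`Γ(M, W)` over `Γ(X, W)` (so that `𝒪_U^k ≅ M|_U`). -/
def IsVectorBundle (k : ℕ) (M : X.Modules) : Prop :=
  ∀ x : X, ∃ (U : X.Opens) (_ : x ∈ U) (e : Fin k → Γ(M, U)),
    ∀ (W : X.Opens) (i : W ⟶ U),
      LinearIndependent Γ(X, W) (fun a => M.presheaf.map i.op (e a)) ∧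
      Submodule.span Γ(X, W) (Set.range fun a => M.presheaf.map i.op (e a)) = ⊤

/-- The presheaf of abelian groups `U ↦ ⋀ᵏ Γ(M, U)`, exterior power over `Γ(X, U)`. -/
def exteriorAb (k : ℕ) (M : X.Modules) : X.Opensᵒᵖ ⥤ Ab.{u} where
  obj U := .of (⋀[Γ(X, U.unop)]^k Γ(M, U.unop))
  map {U V} f := AddCommGrpCat.ofHom
    (exteriorMap k (X.presheaf.map f).hom (M.presheaf.map f).hom
      fun r x => M.map_smul f.unop r x)
  map_id U := by
    refine AddCommGrpCat.hom_ext (exteriorMap_id k _ _ (fun r x => M.map_smul (𝟙 U.unop) r x) ?_ ?_)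
    · exact congrArg CommRingCat.Hom.hom (X.presheaf.map_id U)
    · exact congrArg AddCommGrpCat.Hom.hom (M.presheaf.map_id U)
  map_comp {U V W} f g := by
    refine AddCommGrpCat.hom_ext (exteriorMap_comp k _ _ (fun r x => M.map_smul f.unop r x)
      _ _ (fun r x => M.map_smul g.unop r x) _ _ (fun r x => M.map_smul (f ≫ g).unop r x) ?_ ?_)
    · exact congrArg CommRingCat.Hom.hom (X.presheaf.map_comp f g)
    · exact congrArg AddCommGrpCat.Hom.hom (M.presheaf.map_comp f g)

instance (k : ℕ) (M : X.Modules) (U : X.Opensᵒᵖ) :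
    Module (X.ringCatSheaf.obj.obj U) ((exteriorAb k M).obj U) :=
  inferInstanceAs (Module Γ(X, U.unop) (⋀[Γ(X, U.unop)]^k Γ(M, U.unop)))

/-- The presheaf of modules `U ↦ ⋀ᵏ Γ(M, U)`. -/
def exteriorPresheaf (k : ℕ) (M : X.Modules) : X.PresheafOfModules :=
  PresheafOfModules.ofPresheaf (exteriorAb k M) fun {U V} f r x =>
    exteriorMap_smul (R := Γ(X, U.unop)) (S := Γ(X, V.unop)) k _ _
      (fun r x => M.map_smul f.unop r x) r x

/-- The `k`-th exterior power `⋀ᵏ M` of a sheaf of modules: the sheaf associated to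
`U ↦ ⋀ᵏ Γ(M, U)`. -/
def wedge (k : ℕ) (M : X.Modules) : X.Modules :=
  (PresheafOfModules.sheafification (𝟙 X.ringCatSheaf.obj)).obj (exteriorPresheaf k M)

/-- The first Chern class of a rank `k` vector bundle `M`, with values in the Picard group of `X`
(seen inside the isomorphism classes of sheaves of modules): the class of `det M = ⋀ᵏ M`. -/
def firstChernClass (k : ℕ) (M : X.Modules) : Quotient (isIsomorphicSetoid X.Modules) :=
  Quotient.mk _ (wedge k M)

/-! ### The dual of a sheaf of modules -/

/-- Sections over `U` of `M^* = Hom(M, 𝒪_X)`: the morphisms `M|_U → 𝒪_U`, i.e. families of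
`Γ(X, W)`-linear maps `Γ(M, W) → Γ(X, W)`, `W ⊆ U`, that commute with restriction. -/
def dualSections (M : X.Modules) (U : X.Opens) :
    AddSubgroup (∀ W : {W : X.Opens // W ≤ U}, Γ(M, W.1) →ₗ[Γ(X, W.1)] Γ(X, W.1)) where
  carrier := {φ | ∀ (W W' : {W : X.Opens // W ≤ U}) (i : W'.1 ⟶ W.1) (m : Γ(M, W.1)),
    φ W' (M.presheaf.map i.op m) = X.presheaf.map i.op (φ W m)}
  zero_mem' := by intro W W' i m; simp
  add_mem' := by intro a b ha hb W W' i m; simp [ha W W' i m, hb W W' i m]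
  neg_mem' := by intro a ha W W' i m; simp [ha W W' i m]

variable {M : X.Modules} {U V : X.Opens}

lemma dualSections_map (φ : dualSections M U) (W W' : {W : X.Opens // W ≤ U}) (i : W'.1 ⟶ W.1)
    (m : Γ(M, W.1)) : φ.1 W' (M.presheaf.map i.op m) = X.presheaf.map i.op (φ.1 W m) :=
  φ.2 W W' i m

instance : SMul Γ(X, U) (dualSections M U) where
  smul r φ := ⟨fun W => X.presheaf.map (homOfLE W.2).op r • φ.1 W, by
    intro W W' i m
    simp only [LinearMap.smul_apply, dualSections_map φ W W' i m, smul_eq_mul, map_mul]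
    rw [← CommRingCat.comp_apply, ← X.presheaf.map_comp]
    rfl⟩

lemma dualSections_smul (r : Γ(X, U)) (φ : dualSections M U) (W : {W : X.Opens // W ≤ U})
    (m : Γ(M, W.1)) : (r • φ).1 W m = X.presheaf.map (homOfLE W.2).op r * φ.1 W m := rfl

lemma dualSections_ext {φ ψ : dualSections M U} (h : ∀ W m, φ.1 W m = ψ.1 W m) : φ = ψ :=
  Subtype.ext (funext fun W => LinearMap.ext (h W))

instance : Module Γ(X, U) (dualSections M U) where
  one_smul φ := dualSections_ext fun W m => by simp [dualSections_smul]
  mul_smul r s φ := dualSections_ext fun W m => by simp [dualSections_smul, mul_assoc]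
  smul_zero r := dualSections_ext fun W m => by simp [dualSections_smul]
  smul_add r φ ψ := dualSections_ext fun W m => by simp [dualSections_smul, mul_add]
  add_smul r s φ := dualSections_ext fun W m => by simp [dualSections_smul, add_mul]
  zero_smul φ := dualSections_ext fun W m => by simp [dualSections_smul]

/-- Restriction of sections of `M^*`. -/
def dualRes (M : X.Modules) (h : V ≤ U) : dualSections M U →+ dualSections M V where
  toFun φ := ⟨fun W => φ.1 ⟨W.1, W.2.trans h⟩, fun W W' i m =>
    φ.2 ⟨W.1, W.2.trans h⟩ ⟨W'.1, W'.2.trans h⟩ i m⟩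
  map_zero' := rfl
  map_add' _ _ := rfl

/-- The underlying presheaf of abelian groups of `M^*`. -/
def dualAb (M : X.Modules) : X.Opensᵒᵖ ⥤ Ab.{u} where
  obj U := .of (dualSections M U.unop)
  map f := AddCommGrpCat.ofHom (dualRes M f.unop.le)

instance (M : X.Modules) (U : X.Opensᵒᵖ) :
    Module (X.ringCatSheaf.obj.obj U) ((dualAb M).obj U) :=
  inferInstanceAs (Module Γ(X, U.unop) (dualSections M U.unop))

/-- `M^*` as a presheaf of modules. -/
def dualPresheaf (M : X.Modules) : X.PresheafOfModules :=
  PresheafOfModules.ofPresheaf (dualAb M) fun {U V} f (r : Γ(X, U.unop)) φ =>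
    dualSections_ext fun W m => by
      change X.presheaf.map _ r * _ = X.presheaf.map _ (X.presheaf.map f r) * _
      rw [← CommRingCat.comp_apply, ← X.presheaf.map_comp]
      rfl

lemma dualPresheaf_isSheaf (M : X.Modules) : TopCat.Presheaf.IsSheaf (dualAb M) := by
  rw [TopCat.Presheaf.isSheaf_iff_isSheafUniqueGluing]
  intro ι U sf hsf
  let O : TopCat.Sheaf CommRingCat X := X.sheaf
  let f (i : ι) : dualSections M (U i) := sf i
  -- the cover of `W` by the `W ⊓ U i`
  have hcov (W : X.Opens) (hW : W ≤ iSup U) : W ≤ iSup fun i => W ⊓ U i := by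
    rw [← inf_iSup_eq]; exact le_inf le_rfl hW
  let loc (W : X.Opens) (m : Γ(M, W)) (i : ι) : Γ(X, W ⊓ U i) :=
    (f i).1 ⟨W ⊓ U i, inf_le_right⟩ (M.presheaf.map (homOfLE inf_le_left).op m)
  have hagree (i j : ι) (W : X.Opens) (hi : W ≤ U i) (hj : W ≤ U j) (m : Γ(M, W)) :
      (f i).1 ⟨W, hi⟩ m = (f j).1 ⟨W, hj⟩ m := by
    have h := congrArg (fun φ : dualSections M (U i ⊓ U j) => φ.1 ⟨W, le_inf hi hj⟩ m) (hsf i j)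
    exact h
  have hex (W : X.Opens) (hW : W ≤ iSup U) (m : Γ(M, W)) :
      ∃! s : Γ(X, W), ∀ i, X.presheaf.map (homOfLE (inf_le_left : W ⊓ U i ≤ W)).op s =
        loc W m i := by
    refine TopCat.Sheaf.existsUnique_gluing' O (fun i => W ⊓ U i) W
      (fun i => homOfLE inf_le_left) (hcov W hW) (loc W m) ?_
    intro i j
    change X.presheaf.map _ _ = X.presheaf.map _ _
    simp only [loc]
    rw [← dualSections_map (f i) ⟨W ⊓ U i, inf_le_right⟩
      ⟨(W ⊓ U i) ⊓ (W ⊓ U j), inf_le_left.trans inf_le_right⟩,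
      ← dualSections_map (f j) ⟨W ⊓ U j, inf_le_right⟩
      ⟨(W ⊓ U i) ⊓ (W ⊓ U j), inf_le_right.trans inf_le_right⟩, hagree i j,
      ← AddCommGrpCat.comp_apply, ← AddCommGrpCat.comp_apply, ← M.presheaf.map_comp,
      ← M.presheaf.map_comp]
    rfl
  choose g hg hguniq using hex
  have hres (i : ι) (W : X.Opens) (m : Γ(M, W)) (hW : W ≤ U i) (h : W ≤ iSup U) :
      g W h m = (f i).1 ⟨W, hW⟩ m := by
    refine (hguniq W h m _ fun j => ?_).symm
    rw [← dualSections_map (f i) ⟨W, hW⟩ ⟨W ⊓ U j, inf_le_left.trans hW⟩, hagree i j]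
  have hglue (W : X.Opens) (h : W ≤ iSup U) (s t : Γ(X, W))
      (hst : ∀ i, X.presheaf.map (homOfLE (inf_le_left : W ⊓ U i ≤ W)).op s =
        X.presheaf.map (homOfLE inf_le_left).op t) : s = t :=
    TopCat.Sheaf.eq_of_locally_eq' O (fun i => W ⊓ U i) W (fun i => homOfLE inf_le_left)
      (hcov W h) s t hst
  let G : dualSections M (iSup U) :=
    ⟨fun W =>
      { toFun := g W.1 W.2
        map_add' := fun m n => (hguniq W.1 W.2 (m + n) (g W.1 W.2 m + g W.1 W.2 n) fun i => by
          simp only [map_add, hg, loc]).symm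
        map_smul' := fun r m => (hguniq W.1 W.2 (r • m) (r * g W.1 W.2 m) fun i => by
          simp only [smul_eq_mul, map_mul, hg, loc, M.map_smul, map_smul]).symm },
      by
        intro W W' i m
        refine hglue W'.1 W'.2 _ _ fun j => ?_
        change X.presheaf.map _ (g W'.1 W'.2 _) = X.presheaf.map _ (X.presheaf.map _ (g W.1 W.2 m))
        have h1 : X.presheaf.map (homOfLE (inf_le_left : W'.1 ⊓ U j ≤ W'.1)).op
            (X.presheaf.map i.op (g W.1 W.2 m)) =
            X.presheaf.map (homOfLE (inf_le_inf_right (U j) i.le)).op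
              (X.presheaf.map (homOfLE (inf_le_left : W.1 ⊓ U j ≤ W.1)).op (g W.1 W.2 m)) := by
          rw [← CommRingCat.comp_apply, ← CommRingCat.comp_apply, ← X.presheaf.map_comp,
            ← X.presheaf.map_comp]
          rfl
        rw [h1, hg, hg]
        simp only [loc]
        rw [← dualSections_map (f j) ⟨W.1 ⊓ U j, inf_le_right⟩ ⟨W'.1 ⊓ U j, inf_le_right⟩,
          ← AddCommGrpCat.comp_apply, ← AddCommGrpCat.comp_apply, ← M.presheaf.map_comp,
          ← M.presheaf.map_comp]
        rfl⟩
  refine ⟨G, fun i => ?_, fun H hH => ?_⟩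
  · exact dualSections_ext fun W m => hres i W.1 m W.2 _
  · refine dualSections_ext fun W m => hguniq W.1 W.2 m _ fun i => ?_
    have h := congrArg (fun φ : dualSections M (U i) => φ.1 ⟨W.1 ⊓ U i, inf_le_right⟩
      (M.presheaf.map (homOfLE (inf_le_left : W.1 ⊓ U i ≤ W.1)).op m)) (hH i)
    have h2 := dualSections_map (M := M) H W ⟨W.1 ⊓ U i, inf_le_left.trans W.2⟩
      (homOfLE inf_le_left) m
    exact h2.symm.trans h

/-- The dual `M^* = Hom(M, 𝒪_X)` of a sheaf of modules. -/
def dual (M : X.Modules) : X.Modules :=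
  (⟨dualPresheaf M, dualPresheaf_isSheaf M⟩ : SheafOfModules X.ringCatSheaf)

/-! ### Global sections, trivial bundles and evaluation over the complex numbers -/

/-- A curve: a smooth connected complete scheme of dimension one over `ℂ`. -/
structure IsCurve {C : Scheme.{0}} (f : C ⟶ Spec (.of ℂ)) : Prop where
  proper : IsProper f
  smooth : SmoothOfRelativeDimension 1 f
  connected : ConnectedSpace C

variable {C : Scheme.{0}} (f : C ⟶ Spec (.of ℂ))

/-- The functor `M ↦ H⁰(C, M)` to complex vector spaces (`H⁰` of a direct image to `Spec ℂ`). -/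
def H0 : C.Modules ⥤ ModuleCat.{0} ℂ :=
  Scheme.Modules.pushforward f ⋙ moduleSpecΓFunctor (R := CommRingCat.of ℂ)

/-- The functor `V ↦ V ⊗ 𝒪_C` on complex vector spaces: the inverse image of the sheaf on `Spec ℂ`
given by `V`. -/
def trivialBundle : ModuleCat.{0} ℂ ⥤ C.Modules :=
  tilde.functor (CommRingCat.of ℂ) ⋙ Scheme.Modules.pullback f

/-- A linear map `V → H⁰(C, M)` is the same as a morphism `V ⊗ 𝒪_C → M`. -/
def trivialBundleAdjunction : trivialBundle f ⊣ H0 f :=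
  (tilde.adjunction (R := CommRingCat.of ℂ)).comp (Scheme.Modules.pullbackPushforwardAdjunction f)

/-- The evaluation map `P ⊗ 𝒪_C → M` of a space `P ⊆ H⁰(C, M)` of global sections. -/
def evaluation {M : C.Modules} (P : Submodule ℂ ((H0 f).obj M)) :
    (trivialBundle f).obj (ModuleCat.of ℂ P) ⟶ M :=
  ((trivialBundleAdjunction f).homEquiv _ _).symm 
    (ModuleCat.ofHom (X := P) (Y := (H0 f).obj M) P.subtype)

/-- `P ⊆ H⁰(C, M)` generates `M`: the evaluation map is an epimorphism of sheaves. -/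
def Generates {M : C.Modules} (P : Submodule ℂ ((H0 f).obj M)) : Prop :=
  Epi (evaluation f P)

end CurveBundle

end

open CategoryTheory Opposite AlgebraicGeometry TopologicalSpace

noncomputable section

namespace CurveBundle

universe u

/-! ### Sections, restriction, and local criteria for morphisms of sheaves of modules. -/

section Sections

variable {X : Scheme.{u}} {M N K : X.Modules} {U V W : X.Opens}

/-! The bundle `E_V^*` is the kernel `K` of the evaluation on `P ⊗ 𝒪`, up to replacing `K` by its
double dual. Everything rests on identifying the kernel of the smaller evaluation `S ⊗ 𝒪 → M` with
`L^*`.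

That identification is Cramer's rule. In a local frame of `M`, the `k + 1` sections from a basis of
`S` form a `k × (k + 1)` matrix, and its signed maximal minors are a relation between them
(`sum_minor_smul`). Since the sections generate, the minors generate the unit ideal
(`exists_sum_mul_minor`), and then every relation is a multiple of the vector of minors
(`eq_smul_minor`). The minors depend on the frame only through `det M`. Pairing a form on `L ≃ det
M` with the wedges of `k` of the sections therefore gives a global map `L^* → S ⊗ 𝒪`, and
`koszul_shortExact` proves `0 → L^* → S ⊗ 𝒪 → M → 0` exact.

Both evaluations map onto `M`, and `S ⊗ 𝒪 → P ⊗ 𝒪` is split with cokernel `V ⊗ 𝒪`. The snake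
argument `exists_kernel_shortExact` turns this into `0 → L^* → K → V ⊗ 𝒪 → 0`. Hence `K` is an
extension of bundles of ranks `k` and `1`, so it is a bundle of rank `k + 1`
(`IsVectorBundle.extension`) and is reflexive, and `E = K^*` works.

For the bound on `h⁰`, a linear form on `P ⊗ 𝒪` that vanishes on `K` factors through `M`, hence is
zero because `h⁰(M^*) = 0`. The `2k + 1` dual coordinates of `P` thus stay independent in `H⁰(K^*)`
(`rank_H0_dual_ge`). -/

/-- Restriction of functions. -/
def resO (h : V ≤ U) : Γ(X, U) →+* Γ(X, V) := (X.presheaf.map (homOfLE h).op).hom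

/-- Restriction of sections of a sheaf of modules. -/
def res (M : X.Modules) (h : V ≤ U) : Γ(M, U) →ₛₗ[resO h] Γ(M, V) where
  toFun := M.presheaf.map (homOfLE h).op
  map_add' := map_add _
  map_smul' := M.map_smul (homOfLE h)

@[simp] lemma res_self (x : Γ(M, U)) : res M le_rfl x = x :=
  ConcreteCategory.congr_hom (M.presheaf.map_id (op U)) x

@[simp] lemma resO_self (x : Γ(X, U)) : resO le_rfl x = x :=
  ConcreteCategory.congr_hom (X.presheaf.map_id (op U)) x

@[simp] lemma res_res (h : V ≤ U) (h' : W ≤ V) (x : Γ(M, U)) :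
    res M h' (res M h x) = res M (h'.trans h) x :=
  (ConcreteCategory.congr_hom (M.presheaf.map_comp (homOfLE h).op (homOfLE h').op) x).symm

/-- The linear map on sections of a morphism of sheaves of modules. -/
def appL (φ : M ⟶ N) (U : X.Opens) : Γ(M, U) →ₗ[Γ(X, U)] Γ(N, U) where
  toFun := φ.app U
  map_add' := map_add _
  map_smul' := φ.app_smul

lemma appL_res (φ : M ⟶ N) (h : V ≤ U) (x : Γ(M, U)) :
    appL φ V (res M h x) = res N h (appL φ U x) :=
  ConcreteCategory.congr_hom (φ.mapPresheaf.naturality (homOfLE h).op) x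

@[simp] lemma appL_comp (φ : M ⟶ N) (ψ : N ⟶ K) (x : Γ(M, U)) :
    appL (φ ≫ ψ) U x = appL ψ U (appL φ U x) := rfl

@[simp] lemma appL_id (x : Γ(M, U)) : appL (𝟙 M) U x = x := rfl

@[simp] lemma appL_zero (x : Γ(M, U)) : appL (0 : M ⟶ N) U x = 0 := rfl

@[simp] lemma appL_add (φ ψ : M ⟶ N) (x : Γ(M, U)) :
    appL (φ + ψ) U x = appL φ U x + appL ψ U x := rfl

lemma appL_sum {ι : Type*} (s : Finset ι) (φ : ι → (M ⟶ N)) (x : Γ(M, U)) :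
    appL (∑ i ∈ s, φ i) U x = ∑ i ∈ s, appL (φ i) U x := by
  classical
  induction s using Finset.induction_on with
  | empty => simp
  | insert a s ha ih => rw [Finset.sum_insert ha, Finset.sum_insert ha, appL_add, ih]

lemma hom_ext_appL {φ ψ : M ⟶ N} (h : ∀ U x, appL φ U x = appL ψ U x) : φ = ψ :=
  Scheme.Modules.hom_ext _ _ fun U => by ext x; exact h U x

/-- A morphism of sheaves of modules from its effect on sections. -/
def homOfLinear (φ : ∀ U : X.Opens, Γ(M, U) →ₗ[Γ(X, U)] Γ(N, U))
    (hφ : ∀ (U V : X.Opens) (h : V ≤ U) (x : Γ(M, U)), φ V (res M h x) = res N h (φ U x)) :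
    M ⟶ N :=
  (Scheme.Modules.fullyFaithfulToPresheafOfModules (X := X)).preimage
    (PresheafOfModules.homMk
      { app := fun U => AddCommGrpCat.ofHom (φ U.unop).toAddMonoidHom
        naturality := fun U V i => by
          ext x
          exact hφ U.unop V.unop i.unop.le x }
      fun U r m => (φ U.unop).map_smul r m)

@[simp] lemma appL_homOfLinear (φ : ∀ U : X.Opens, Γ(M, U) →ₗ[Γ(X, U)] Γ(N, U))
    (hφ : ∀ (U V : X.Opens) (h : V ≤ U) (x : Γ(M, U)), φ V (res M h x) = res N h (φ U x))
    (x : Γ(M, U)) : appL (homOfLinear φ hφ) U x = φ U x := rfl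

/-- The structure sheaf as a sheaf of modules. -/
def structureModule (X : Scheme.{u}) : X.Modules := SheafOfModules.unit X.ringCatSheaf

/-- Functions are the sections of the structure sheaf. -/
def toO (U : X.Opens) : Γ(X, U) ≃ₗ[Γ(X, U)] Γ(structureModule X, U) where
  toFun x := x
  invFun x := x
  map_add' _ _ := rfl
  map_smul' _ _ := rfl
  left_inv _ := rfl
  right_inv _ := rfl

lemma res_toO (h : V ≤ U) (r : Γ(X, U)) :
    res (structureModule X) h (toO U r) = toO V (resO h r) := rfl

lemma resO_toO_symm (h : V ≤ U) (r : Γ(structureModule X, U)) :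
    resO h ((toO U).symm r) = (toO V).symm (res (structureModule X) h r) := rfl

/-- Sections that agree locally are equal. -/
lemma eq_of_locally {a b : Γ(M, U)}
    (h : ∀ x ∈ U, ∃ (V : X.Opens) (i : V ≤ U), x ∈ V ∧ res M i a = res M i b) : a = b := by
  refine TopCat.Presheaf.IsSheaf.section_ext M.isSheaf fun x hx => ?_
  obtain ⟨V, i, hxV, e⟩ := h x hx
  exact ⟨V, i, hxV, e⟩

lemma eq_of_locallyO {a b : Γ(X, U)}
    (h : ∀ x ∈ U, ∃ (V : X.Opens) (i : V ≤ U), x ∈ V ∧ resO i a = resO i b) : a = b := by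
  refine (toO U).injective (eq_of_locally fun x hx => ?_)
  obtain ⟨V, i, hxV, e⟩ := h x hx
  exact ⟨V, i, hxV, by rw [res_toO, res_toO, e]⟩

/-- A family of functions on neighbourhoods of the points of `U` that agree on overlaps glues. -/
lemma exists_glueO (D : U → X.Opens) (hD : ∀ x, D x ≤ U) (hx : ∀ x : U, x.1 ∈ D x)
    (s : ∀ x, Γ(X, D x))
    (hs : ∀ x y, resO (inf_le_left : D x ⊓ D y ≤ D x) (s x) = resO inf_le_right (s y)) :
    ∃ t : Γ(X, U), ∀ x, resO (hD x) t = s x := by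
  obtain ⟨t, ht, -⟩ := TopCat.Sheaf.existsUnique_gluing' X.sheaf D U (fun x => homOfLE (hD x))
    (fun x hxU => Opens.mem_iSup.2 ⟨⟨x, hxU⟩, hx ⟨x, hxU⟩⟩) s fun x y => hs x y
  exact ⟨t, ht⟩

lemma mono_of_injective (φ : M ⟶ N) (h : ∀ U x, appL φ U x = 0 → x = 0) : Mono φ :=
  Preadditive.mono_of_cancel_zero _ fun g hg => hom_ext_appL fun U x =>
    h U _ (by rw [← appL_comp, hg]; rfl)

/-- Every section of `N` is locally in the image of `φ`. -/
def LocSurj (φ : M ⟶ N) : Prop :=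
  ∀ (U : X.Opens) (y : Γ(N, U)), ∀ x ∈ U, ∃ (V : X.Opens) (i : V ≤ U), x ∈ V ∧
    ∃ z : Γ(M, V), appL φ V z = res N i y

lemma LocSurj.epi {φ : M ⟶ N} (h : LocSurj φ) : Epi φ :=
  Preadditive.epi_of_cancel_zero _ fun g hg => hom_ext_appL fun U y =>
    eq_of_locally fun x hx => by
      obtain ⟨V, i, hxV, z, hz⟩ := h U y x hx
      refine ⟨V, i, hxV, ?_⟩
      rw [← appL_res, ← hz, ← appL_comp, hg, appL_zero, appL_zero, map_zero]

/-- The functor of sections over `U`. -/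
def sectionsAb (U : X.Opens) : X.Modules ⥤ Ab.{u} :=
  Scheme.Modules.toPresheaf X ⋙ (CategoryTheory.evaluation _ Ab.{u}).obj (op U)

instance (U : X.Opens) : (sectionsAb U).Additive := ⟨rfl⟩

/-- Left exactness of sections: limits of sheaves are computed in presheaves, and limits of
presheaves objectwise. -/
instance (U : X.Opens) : Limits.PreservesFiniteLimits (sectionsAb U) :=
  have : Limits.PreservesFiniteLimits ((CategoryTheory.evaluation (Opens X)ᵒᵖ Ab.{u}).obj (op U)) :=
    ⟨fun _ _ _ => inferInstance⟩
  Limits.comp_preservesFiniteLimits _ _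

/-- Sections of an exact sequence `0 → A → B → D`. -/
lemma exact_sections (S : ShortComplex X.Modules) (hS : S.Exact) [Mono S.f] (U : X.Opens)
    (y : Γ(S.X₂, U)) (hy : appL S.g U y = 0) : ∃ z, appL S.f U z = y :=
  (ShortComplex.ab_exact_iff _).1
    (hS.map_of_mono_of_preservesKernel (sectionsAb U) inferInstance inferInstance) y hy

lemma injective_of_mono (φ : M ⟶ N) [Mono φ] (U : X.Opens) : Function.Injective (appL φ U) :=
  (AddCommGrpCat.mono_iff_injective ((sectionsAb U).map φ)).1 inferInstance

end Sections

/-! ### Sheafification and local surjectivity of epimorphisms. -/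

section Sheafification

variable {X : Scheme.{u}} {U V : X.Opens}

/-- The sheaf of modules associated to a presheaf of modules. -/
def sheafOf (P : X.PresheafOfModules) : X.Modules :=
  (PresheafOfModules.sheafification (𝟙 X.ringCatSheaf.obj)).obj P

/-- The morphism from a presheaf of modules to its associated sheaf. -/
def toSheafOf (P : X.PresheafOfModules) : P ⟶ (sheafOf P).val :=
  (PresheafOfModules.sheafificationAdjunction (𝟙 X.ringCatSheaf.obj)).unit.app P

/-- The map on sections over `U` from a presheaf of modules to its associated sheaf. -/
def shSec (P : X.PresheafOfModules) (U : X.Opens) : P.obj (op U) →+ Γ(sheafOf P, U) :=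
  ((toSheafOf P).app (op U)).hom.toAddMonoidHom

lemma shSec_smul (P : X.PresheafOfModules) (r : Γ(X, U)) (x : P.obj (op U)) :
    shSec P U ((show X.ringCatSheaf.obj.obj (op U) from r) • x) = r • shSec P U x :=
  ((toSheafOf P).app (op U)).hom.map_smul _ x

lemma shSec_res (P : X.PresheafOfModules) (h : V ≤ U) (x : P.obj (op U)) :
    shSec P V (P.map (homOfLE h).op x) = res (sheafOf P) h (shSec P U x) :=
  PresheafOfModules.naturality_apply (toSheafOf P) (homOfLE h).op x

/-- The associated sheaf of modules has the abelian sheafification as underlying sheaf, and two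
sections with the same image there agree on a covering sieve. -/
lemma shSec_locInj (P : X.PresheafOfModules) (x : P.obj (op U)) (h : shSec P U x = 0) :
    ∀ p ∈ U, ∃ (V : X.Opens) (i : V ≤ U), p ∈ V ∧ P.map (homOfLE i).op x = 0 := by
  intro p hp
  obtain ⟨V, i, hi, hpV⟩ := Presheaf.equalizerSieve_mem (Opens.grothendieckTopology X)
    (CategoryTheory.toSheafify (Opens.grothendieckTopology X) P.presheaf) (X := op U) x 0
    (h.trans (map_zero (shSec P U)).symm) p hp
  exact ⟨V, i.le, hpV, hi.trans (map_zero (P.presheaf.map i.op).hom)⟩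

lemma shSec_locSurj (P : X.PresheafOfModules) (y : Γ(sheafOf P, U)) :
    ∀ p ∈ U, ∃ (V : X.Opens) (i : V ≤ U), p ∈ V ∧ ∃ x, shSec P V x = res _ i y := by
  intro p hp
  obtain ⟨V, i, ⟨x, hx⟩, hpV⟩ := Presheaf.imageSieve_mem (Opens.grothendieckTopology X)
    (CategoryTheory.toSheafify (Opens.grothendieckTopology X) P.presheaf) y p hp
  exact ⟨V, i.le, hpV, x, hx⟩

/-- The projection from `N` to the sheafified presheaf cokernel kills `φ`, hence is zero. So the
class of a section in the presheaf cokernel is locally zero, and presheaf cokernels are computed on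
each open set. -/
lemma locSurj_of_epi {M N : X.Modules} (φ : M ⟶ N) [Epi φ] : LocSurj φ := by
  intro U y p hp
  let α : M.val ⟶ N.val := (Scheme.Modules.toPresheafOfModules X).map φ
  let π := Limits.cokernel.π α
  let q : N ⟶ sheafOf (Limits.cokernel α) :=
    (Scheme.Modules.fullyFaithfulToPresheafOfModules (X := X)).preimage (π ≫ toSheafOf _)
  have hq : q = 0 := by
    rw [← cancel_epi φ, Limits.comp_zero]
    refine (Scheme.Modules.toPresheafOfModules X).map_injective ?_
    rw [Functor.map_comp, Functor.FullyFaithful.map_preimage]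
    exact (Category.assoc _ _ _).symm.trans
      ((congrArg (· ≫ toSheafOf _) (Limits.cokernel.condition α)).trans Limits.zero_comp)
  have h0 : shSec (Limits.cokernel α) U (π.app (op U) y) = 0 := by
    change appL q U y = 0
    rw [hq, appL_zero]
  obtain ⟨V, i, hpV, hV⟩ := shSec_locInj _ _ h0 p hp
  refine ⟨V, i, hpV, ?_⟩
  have hV' : π.app (op V) (N.val.map (homOfLE i).op y) = 0 :=
    (PresheafOfModules.naturality_apply π (homOfLE i).op y).trans hV
  let S : ShortComplex X.PresheafOfModules := ShortComplex.mk α π (Limits.cokernel.condition α)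
  have hS : S.Exact := ShortComplex.exact_cokernel α
  have := hS.map_of_epi_of_preservesCokernel (PresheafOfModules.evaluation _ (op V))
    inferInstance inferInstance
  exact (ShortComplex.moduleCat_exact_iff _).1 this _ hV'

end Sheafification

/-! ### Local frames. -/

section Frames

variable {X : Scheme.{u}} {M N : X.Modules} {U V W : X.Opens} {ι κ : Type*} [Fintype ι] [Fintype κ]

/-- The sections `e i` over `U` form a basis on every open subset of `U`. -/
def IsFrame (e : ι → Γ(M, U)) : Prop :=
  ∀ (W : X.Opens) (h : W ≤ U),
    (∀ c : ι → Γ(X, W), ∑ i, c i • res M h (e i) = 0 → ∀ i, c i = 0) ∧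
    ∀ m : Γ(M, W), ∃ c : ι → Γ(X, W), ∑ i, c i • res M h (e i) = m

lemma isVectorBundle_iff (k : ℕ) : IsVectorBundle k M ↔
    ∀ x : X, ∃ (U : X.Opens) (_ : x ∈ U) (e : Fin k → Γ(M, U)), IsFrame e := by
  refine forall_congr' fun x => exists_congr fun U => exists_congr fun _ => exists_congr fun e => ?_
  refine ⟨fun h W i => ?_, fun h W i => ?_⟩
  · obtain ⟨h1, h2⟩ := h W (homOfLE i)
    refine ⟨Fintype.linearIndependent_iff.1 h1, fun m => ?_⟩
    have : m ∈ Submodule.span Γ(X, W) (Set.range fun a => res M i (e a)) := by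
      erw [h2]; trivial
    exact (Submodule.mem_span_range_iff_exists_fun _).1 this
  · obtain ⟨h1, h2⟩ := h W i.le
    refine ⟨Fintype.linearIndependent_iff.2 h1, ?_⟩
    rw [eq_top_iff]
    exact fun m _ => (Submodule.mem_span_range_iff_exists_fun _).2 (h2 m)

lemma IsFrame.res {e : ι → Γ(M, U)} (he : IsFrame e) (h : V ≤ U) :
    IsFrame fun i => res M h (e i) := fun W hW => by
  simpa using he W (hW.trans h)

lemma IsFrame.reindex {e : ι → Γ(M, U)} (he : IsFrame e) (σ : κ ≃ ι) :
    IsFrame fun i => e (σ i) := fun W hW => by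
  obtain ⟨h1, h2⟩ := he W hW
  refine ⟨fun c hc i => ?_, fun m => ?_⟩
  · have := h1 (fun i => c (σ.symm i)) (by
      rw [← hc, ← Equiv.sum_comp σ]; simp) (σ i)
    simpa using this
  · obtain ⟨c, rfl⟩ := h2 m
    exact ⟨fun i => c (σ i), Equiv.sum_comp σ fun i => c i • CurveBundle.res M hW (e i)⟩

/-- The basis of sections given by a frame. -/
def IsFrame.basis {e : ι → Γ(M, U)} (he : IsFrame e) (h : W ≤ U) :
    Module.Basis ι Γ(X, W) Γ(M, W) :=
  Module.Basis.mk (v := fun i => CurveBundle.res M h (e i))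
    (Fintype.linearIndependent_iff.2 (he W h).1)
    fun m _ => (Submodule.mem_span_range_iff_exists_fun _).2 ((he W h).2 m)

@[simp] lemma IsFrame.basis_apply {e : ι → Γ(M, U)} (he : IsFrame e) (h : W ≤ U) (i : ι) :
    he.basis h i = CurveBundle.res M h (e i) := Module.Basis.mk_apply _ _ i

/-- Coordinates of a section with respect to a frame. -/
def IsFrame.coord {e : ι → Γ(M, U)} (he : IsFrame e) (h : W ≤ U) (i : ι) :
    Γ(M, W) →ₗ[Γ(X, W)] Γ(X, W) := (he.basis h).coord i

lemma IsFrame.sum_coord {e : ι → Γ(M, U)} (he : IsFrame e) (h : W ≤ U) (m : Γ(M, W)) :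
    ∑ i, he.coord h i m • CurveBundle.res M h (e i) = m := by
  simpa [IsFrame.coord] using (he.basis h).sum_repr m

lemma IsFrame.coord_sum {e : ι → Γ(M, U)} (he : IsFrame e) (h : W ≤ U) (c : ι → Γ(X, W)) (j : ι) :
    he.coord h j (∑ i, c i • CurveBundle.res M h (e i)) = c j := by
  have := congrFun ((he.basis h).equivFun.apply_symm_apply c) j
  rw [Module.Basis.equivFun_symm_apply] at this
  simpa [IsFrame.coord] using this

lemma IsFrame.coord_self [DecidableEq ι] {e : ι → Γ(M, U)} (he : IsFrame e) (h : W ≤ U) (i j : ι) :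
    he.coord h j (CurveBundle.res M h (e i)) = if i = j then 1 else 0 := by
  rw [← he.basis_apply, IsFrame.coord, Module.Basis.coord_apply, Module.Basis.repr_self,
    Finsupp.single_apply]

lemma IsFrame.coord_res {e : ι → Γ(M, U)} (he : IsFrame e) (h : W ≤ U) (h' : V ≤ W) (m : Γ(M, W))
    (i : ι) : he.coord (h'.trans h) i (CurveBundle.res M h' m) = resO h' (he.coord h i m) := by
  conv_lhs => rw [← he.sum_coord h m, map_sum]
  simp only [map_smulₛₗ, res_res]
  exact he.coord_sum _ _ i

lemma IsFrame.ext {e : ι → Γ(M, U)} (he : IsFrame e) (h : W ≤ U) {m m' : Γ(M, W)}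
    (hm : ∀ i, he.coord h i m = he.coord h i m') : m = m' := by
  rw [← he.sum_coord h m, ← he.sum_coord h m']
  simp only [hm]

lemma IsFrame.eq_zero_of_appL {φ : M ⟶ N} {e : ι → Γ(M, U)} (he : IsFrame e)
    (he' : IsFrame fun i => appL φ U (e i)) (h : W ≤ U) {m : Γ(M, W)} (hm : appL φ W m = 0) :
    m = 0 := by
  rw [← he.sum_coord h m] at hm ⊢
  simp only [map_sum, map_smul, appL_res] at hm
  have := (he' W h).1 _ hm
  simp [this]

lemma IsFrame.exists_appL {φ : M ⟶ N} {e : ι → Γ(M, U)}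
    (he' : IsFrame fun i => appL φ U (e i)) (h : W ≤ U) (n : Γ(N, W)) :
    ∃ m, appL φ W m = n := by
  obtain ⟨c, hc⟩ := (he' W h).2 n
  exact ⟨∑ i, c i • CurveBundle.res M h (e i), by simpa [appL_res] using hc⟩

/-- A morphism that locally carries frames to frames is an isomorphism. -/
lemma isIso_of_isFrame (φ : M ⟶ N) (h : ∀ x : X, ∃ (U : X.Opens) (_ : x ∈ U) (n : ℕ)
    (e : Fin n → Γ(M, U)), IsFrame e ∧ IsFrame fun i => appL φ U (e i)) : IsIso φ := by
  have : Mono φ := mono_of_injective φ fun W m hm => eq_of_locally fun x hx => by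
    obtain ⟨U, hU, n, e, he, he'⟩ := h x
    refine ⟨W ⊓ U, inf_le_left, ⟨hx, hU⟩, ?_⟩
    rw [map_zero]
    refine he.eq_zero_of_appL he' inf_le_right ?_
    rw [appL_res, hm, map_zero]
  have : Epi φ := LocSurj.epi fun W n x hx => by
    obtain ⟨U, hU, n, e, -, he'⟩ := h x
    exact ⟨W ⊓ U, inf_le_left, ⟨hx, hU⟩, he'.exists_appL inf_le_right _⟩
  exact isIso_of_mono_of_epi φ

lemma IsFrame.appL_of_isIso (φ : M ⟶ N) [IsIso φ] {e : ι → Γ(M, U)} (he : IsFrame e) :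
    IsFrame fun i => appL φ U (e i) := by
  intro W h
  have key (c : ι → Γ(X, W)) : ∑ i, c i • CurveBundle.res N h (appL φ U (e i)) =
      appL φ W (∑ i, c i • CurveBundle.res M h (e i)) := by
    simp [appL_res]
  refine ⟨fun c hc => (he W h).1 c ?_, fun n => ?_⟩
  · rw [key] at hc
    exact injective_of_mono φ W (hc.trans (map_zero _).symm)
  · obtain ⟨c, hc⟩ := (he W h).2 (appL (inv φ) W n)
    refine ⟨c, ?_⟩
    rw [key, hc, ← appL_comp, IsIso.inv_hom_id, appL_id]

/-! ### Duals -/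

/-- The value of a section of `M^*` on a section of `M`. -/
def dualApp (φ : Γ(dual M, U)) (h : W ≤ U) : Γ(M, W) →ₗ[Γ(X, W)] Γ(X, W) :=
  (show dualSections M U from φ).1 ⟨W, h⟩

lemma dualApp_res_right (φ : Γ(dual M, U)) (h : W ≤ U) (h' : V ≤ W) (m : Γ(M, W)) :
    dualApp φ (h'.trans h) (res M h' m) = resO h' (dualApp φ h m) :=
  (show dualSections M U from φ).2 ⟨W, h⟩ ⟨V, h'.trans h⟩ (homOfLE h') m

lemma dualApp_res (φ : Γ(dual M, U)) (h : V ≤ U) (h' : W ≤ V) (m : Γ(M, W)) :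
    dualApp (res (dual M) h φ) h' m = dualApp φ (h'.trans h) m := rfl

lemma dualApp_smul (r : Γ(X, U)) (φ : Γ(dual M, U)) (h : W ≤ U) (m : Γ(M, W)) :
    dualApp (r • φ) h m = resO h r * dualApp φ h m := rfl

lemma dualApp_add (φ ψ : Γ(dual M, U)) (h : W ≤ U) (m : Γ(M, W)) :
    dualApp (φ + ψ) h m = dualApp φ h m + dualApp ψ h m := rfl

lemma dualApp_zero (h : W ≤ U) (m : Γ(M, W)) :
    dualApp (0 : Γ(dual M, U)) h m = 0 := rfl

lemma dualApp_sum {κ : Type*} (s : Finset κ) (φ : κ → Γ(dual M, U)) (h : W ≤ U) (m : Γ(M, W)) :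
    dualApp (∑ i ∈ s, φ i) h m = ∑ i ∈ s, dualApp (φ i) h m := by
  classical
  induction s using Finset.induction_on with
  | empty => exact dualApp_zero h m
  | insert a s ha ih => rw [Finset.sum_insert ha, Finset.sum_insert ha, dualApp_add, ih]

lemma dual_ext {φ ψ : Γ(dual M, U)} (h : ∀ (W : X.Opens) (i : W ≤ U) (m : Γ(M, W)),
    dualApp φ i m = dualApp ψ i m) : φ = ψ :=
  dualSections_ext (φ := φ) (ψ := ψ) fun W m => h W.1 W.2 m

/-- A section of `M^*` from its values. -/
def dualMk (φ : ∀ (W : X.Opens) (_ : W ≤ U), Γ(M, W) →ₗ[Γ(X, W)] Γ(X, W))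
    (hφ : ∀ (W V : X.Opens) (h : W ≤ U) (h' : V ≤ W) (m : Γ(M, W)),
      φ V (h'.trans h) (res M h' m) = resO h' (φ W h m)) : Γ(dual M, U) :=
  (⟨fun W => φ W.1 W.2, fun W W' i m => hφ W.1 W'.1 W.2 i.le m⟩ : dualSections M U)

@[simp] lemma dualApp_dualMk (φ : ∀ (W : X.Opens) (_ : W ≤ U), Γ(M, W) →ₗ[Γ(X, W)] Γ(X, W))
    (hφ : ∀ (W V : X.Opens) (h : W ≤ U) (h' : V ≤ W) (m : Γ(M, W)),
      φ V (h'.trans h) (res M h' m) = resO h' (φ W h m)) (h : W ≤ U) (m : Γ(M, W)) :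
    dualApp (dualMk φ hφ) h m = φ W h m := rfl

/-- Sections of `M^*` that agree on a frame are equal. -/
lemma IsFrame.dual_ext {e : ι → Γ(M, U)} (he : IsFrame e) {φ ψ : Γ(dual M, U)}
    (h : ∀ i, dualApp φ le_rfl (e i) = dualApp ψ le_rfl (e i)) : φ = ψ :=
  CurveBundle.dual_ext fun W hW m => by
    rw [← he.sum_coord hW m]
    simp only [map_sum, map_smul]
    refine Finset.sum_congr rfl fun i _ => ?_
    rw [dualApp_res_right φ le_rfl hW, dualApp_res_right ψ le_rfl hW, h]

/-- The members of the dual frame. -/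
def IsFrame.dualSec {e : ι → Γ(M, U)} (he : IsFrame e) (i : ι) : Γ(dual M, U) :=
  dualMk (fun _ h => he.coord h i) fun _ _ h h' m => he.coord_res h h' m i

lemma IsFrame.dualApp_dualSec_self [DecidableEq ι] {e : ι → Γ(M, U)} (he : IsFrame e) (i j : ι)
    (h : W ≤ U) : dualApp (he.dualSec i) h (CurveBundle.res M h (e j)) = if j = i then 1 else 0 :=
  he.coord_self h j i

lemma IsFrame.sum_dualSec {e : ι → Γ(M, U)} (he : IsFrame e) (h : W ≤ U) (φ : Γ(dual M, W)) :
    ∑ i, dualApp φ le_rfl (CurveBundle.res M h (e i)) • CurveBundle.res (dual M) h (he.dualSec i) =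
      φ := by
  classical
  refine (he.res h).dual_ext fun j => ?_
  simp [dualApp_sum, dualApp_smul, dualApp_res, he.dualApp_dualSec_self]

/-- Evaluating on the original frame reads off the coefficients. -/
lemma IsFrame.dual {e : ι → Γ(M, U)} (he : IsFrame e) : IsFrame he.dualSec := by
  classical
  refine fun W h => ⟨fun c hc j => ?_, fun φ => ⟨_, he.sum_dualSec h φ⟩⟩
  have := congrArg (fun φ : Γ(CurveBundle.dual M, W) =>
    dualApp φ le_rfl (CurveBundle.res M h (e j))) hc
  simpa [dualApp_sum, dualApp_smul, dualApp_res, he.dualApp_dualSec_self, dualApp_zero] using this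

lemma IsVectorBundle.dual {k : ℕ} (hM : IsVectorBundle k M) : IsVectorBundle k (dual M) := by
  rw [isVectorBundle_iff] at hM ⊢
  intro x
  obtain ⟨U, hU, e, he⟩ := hM x
  exact ⟨U, hU, _, he.dual⟩

/-- The morphism from a sheaf of modules to its double dual. -/
def toDoubleDual (M : X.Modules) : M ⟶ dual (dual M) :=
  homOfLinear
    (fun U =>
      { toFun := fun m => dualMk
          (fun W h =>
            { toFun := fun φ => dualApp φ le_rfl (res M h m)
              map_add' := fun φ ψ => dualApp_add φ ψ le_rfl _
              map_smul' := fun r φ => by simp [dualApp_smul] })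
          fun W V h h' φ => by
            simp only [LinearMap.coe_mk, AddHom.coe_mk]
            rw [dualApp_res, ← dualApp_res_right, res_res]
        map_add' := fun m n => dual_ext fun W h φ => by simp [dualApp_add]
        map_smul' := fun r m => dual_ext fun W h φ => by simp [dualApp_smul, map_smulₛₗ] })
    fun U V h m => dual_ext fun W h' φ => by simp [dualApp_res]

lemma dualApp_toDoubleDual (m : Γ(M, U)) (h : W ≤ U) (φ : Γ(dual M, W)) :
    dualApp (appL (toDoubleDual M) U m) h φ = dualApp φ le_rfl (res M h m) := rfl

/-- Biduality carries a frame to the dual of its dual frame. This is what lets a kernel be written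
as the dual of a bundle. -/
lemma IsVectorBundle.isIso_toDoubleDual {k : ℕ} (hM : IsVectorBundle k M) :
    IsIso (toDoubleDual M) := by
  classical
  rw [isVectorBundle_iff] at hM
  refine isIso_of_isFrame _ fun x => ?_
  obtain ⟨U, hU, e, he⟩ := hM x
  refine ⟨U, hU, k, e, he, ?_⟩
  convert he.dual.dual using 2 with i
  refine he.dual.dual_ext fun j => ?_
  have h1 := he.dualApp_dualSec_self j i le_rfl
  have h2 := he.dual.dualApp_dualSec_self i j le_rfl
  simp only [res_self] at h1 h2
  rw [dualApp_toDoubleDual, res_self, h1, h2]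
  simp [eq_comm]

/-! ### Extensions -/

lemma exists_common_open {x : X} (hx : x ∈ U) (P : κ → X.Opens → Prop)
    (hP : ∀ i V W, W ≤ V → P i V → P i W) (h : ∀ i, ∃ V : X.Opens, V ≤ U ∧ x ∈ V ∧ P i V) :
    ∃ V : X.Opens, V ≤ U ∧ x ∈ V ∧ ∀ i, P i V := by
  choose V h1 h2 h3 using h
  refine ⟨U ⊓ Finset.univ.inf V, inf_le_left, ⟨hx, ?_⟩, fun i =>
    hP i _ _ (inf_le_right.trans (Finset.inf_le (Finset.mem_univ i))) (h3 i)⟩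
  have (s : Finset κ) : x ∈ s.inf V := by
    classical
    induction s using Finset.induction_on with
    | empty => simp
    | insert a s _ ih => rw [Finset.inf_insert]; exact ⟨h2 a, ih⟩
  exact this _

/-- Finitely many sections lift along an epimorphism on a common neighbourhood. -/
lemma LocSurj.exists_lift {φ : M ⟶ N} (hφ : LocSurj φ) (y : κ → Γ(N, U)) {x : X} (hx : x ∈ U) :
    ∃ (V : X.Opens) (i : V ≤ U), x ∈ V ∧
      ∃ z : κ → Γ(M, V), ∀ j, appL φ V (z j) = CurveBundle.res N i (y j) := by
  obtain ⟨V, hV, hxV, h⟩ := exists_common_open hx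
    (fun j V => ∃ (i : V ≤ U) (z : Γ(M, V)), appL φ V z = CurveBundle.res N i (y j))
    (fun j V W hWV ⟨i, z, hz⟩ => ⟨hWV.trans i, CurveBundle.res M hWV z, by
      rw [appL_res, hz, res_res]⟩)
    fun j => by
      obtain ⟨V, i, hxV, z, hz⟩ := hφ U (y j) x hx
      exact ⟨V, i, hxV, i, z, hz⟩
  choose i z hz using h
  exact ⟨V, hV, hxV, z, hz⟩

/-- A frame of the subsheaf together with local lifts of a frame of the quotient is a frame of the
middle term. -/
lemma IsVectorBundle.extension {a d : ℕ} (S : ShortComplex X.Modules) (hS : S.ShortExact)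
    (h₁ : IsVectorBundle a S.X₁) (h₃ : IsVectorBundle d S.X₃) : IsVectorBundle (a + d) S.X₂ := by
  rw [isVectorBundle_iff] at h₁ h₃ ⊢
  intro x
  have := hS.mono_f
  have := hS.epi_g
  obtain ⟨U₁, hU₁, e₁, he₁⟩ := h₁ x
  obtain ⟨U₃, hU₃, e₃, he₃⟩ := h₃ x
  obtain ⟨V, hV, hxV, z, hz⟩ := (locSurj_of_epi S.g).exists_lift
    (fun j => CurveBundle.res S.X₃ (inf_le_right : U₁ ⊓ U₃ ≤ U₃) (e₃ j)) ⟨hU₁, hU₃⟩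
  have he₁ := he₁.res (hV.trans inf_le_left)
  have he₃ := he₃.res (hV.trans inf_le_right)
  simp only [res_res] at hz
  suffices h : IsFrame (Sum.elim
      (fun i => appL S.f V (CurveBundle.res _ (hV.trans inf_le_left) (e₁ i))) z) from
    ⟨V, hxV, _, h.reindex finSumFinEquiv.symm⟩
  have hfg (W : X.Opens) (m : Γ(S.X₁, W)) : appL S.g W (appL S.f W m) = 0 := by
    rw [← appL_comp, S.zero, appL_zero]
  intro W hW
  refine ⟨fun c hc => ?_, fun m => ?_⟩
  · have h3 := congrArg (appL S.g W) hc
    simp only [Fintype.sum_sum_type, Sum.elim_inl, Sum.elim_inr, map_add, map_sum, map_smul,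
      appL_res, hfg, hz, smul_zero, Finset.sum_const_zero, zero_add, map_zero] at h3
    have h3' := (he₃ W hW).1 _ h3
    simp only [Fintype.sum_sum_type, Sum.elim_inl, Sum.elim_inr, h3', zero_smul,
      Finset.sum_const_zero, add_zero, ← appL_res, ← map_smul, ← map_sum] at hc
    have h1' := (he₁ W hW).1 _ (injective_of_mono S.f W (hc.trans (map_zero _).symm))
    rintro (i | i)
    exacts [h1' i, h3' i]
  · obtain ⟨c, hc⟩ := (he₃ W hW).2 (appL S.g W m)
    -- Removing the part of `m` seen in the quotient leaves a section of the subsheaf.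
    obtain ⟨n, hn⟩ := exact_sections S hS.exact W (m - ∑ j, c j • CurveBundle.res _ hW (z j)) (by
      simp only [map_sub, map_sum, map_smul, appL_res, hz, hc, sub_self])
    obtain ⟨b, hb⟩ := (he₁ W hW).2 n
    refine ⟨Sum.elim b c, ?_⟩
    simp only [Fintype.sum_sum_type, Sum.elim_inl, Sum.elim_inr, ← appL_res, ← map_smul, ← map_sum]
    simp only [hb, hn, sub_add_cancel]

end Frames

/-! ### Global sections and trivial bundles. -/

section GlobalSections

variable {C : Scheme.{0}} (f : C ⟶ Spec (.of ℂ)) {M N : C.Modules} {U V : C.Opens}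

/-- Constant functions. -/
def scalar : ℂ →+* Γ(C, ⊤) := (f.appTop).hom.comp (Scheme.ΓSpecIso (.of ℂ)).inv.hom

/-- Elements of `H⁰` are global sections. -/
def h0Equiv (M : C.Modules) : (H0 f).obj M ≃+ Γ(M, (⊤ : C.Opens)) where
  toFun x := x
  invFun x := x
  left_inv _ := rfl
  right_inv _ := rfl
  map_add' _ _ := rfl

lemma h0Equiv_smul (c : ℂ) (x : (H0 f).obj M) :
    h0Equiv f M (c • x) = scalar f c • h0Equiv f M x := by
  have h := Scheme.Modules.smul_Spec_def (M := (Scheme.Modules.pushforward f).obj M) (U := ⊤) c x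
  have h1 : ((Spec (.of ℂ)).presheaf.map (Opens.leTop (⊤ : (Spec (.of ℂ)).Opens)).op)
      ((Scheme.ΓSpecIso (.of ℂ)).inv c) = (Scheme.ΓSpecIso (.of ℂ)).inv c :=
    ConcreteCategory.congr_hom ((Spec (.of ℂ)).presheaf.map_id _) _
  rw [h1] at h
  exact h

/-- The morphism `𝒪 → M` given by a global section. -/
def sectionHom (s : Γ(M, (⊤ : C.Opens))) : structureModule C ⟶ M :=
  homOfLinear (fun U => (LinearMap.toSpanSingleton Γ(C, U) _ (res M le_top s)).comp
    (toO U).symm.toLinearMap) fun U V h x => by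
      simp [← resO_toO_symm]

lemma appL_sectionHom (s : Γ(M, (⊤ : C.Opens))) (r : Γ(C, U)) :
    appL (sectionHom s) U (toO U r) = r • res M le_top s := rfl

lemma structureModule_hom_ext {φ ψ : structureModule C ⟶ M}
    (h : appL φ ⊤ (toO ⊤ 1) = appL ψ ⊤ (toO ⊤ 1)) : φ = ψ := by
  refine hom_ext_appL fun U x => ?_
  have hx : x = (toO U).symm x • res _ le_top (toO ⊤ 1) := by
    rw [res_toO, map_one, ← map_smul, smul_eq_mul, mul_one, LinearEquiv.apply_symm_apply]
  rw [hx, map_smul, map_smul, appL_res, appL_res, h]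

instance : Limits.HasFiniteBiproducts C.Modules := Abelian.hasFiniteBiproducts

open Limits in
lemma isFrame_biproduct (n : ℕ) : IsFrame (U := ⊤) fun i : Fin n =>
    appL (biproduct.ι (fun _ : Fin n => structureModule C) i) ⊤ (toO ⊤ 1) := by
  classical
  intro W hW
  simp only [← appL_res, res_toO, map_one]
  refine ⟨fun c hc j => ?_, fun m => ?_⟩
  · have := congrArg (appL (biproduct.π (fun _ : Fin n => structureModule C) j) W) hc
    simp only [map_sum, map_smul, ← appL_comp, map_zero] at this
    rw [Finset.sum_eq_single j] at this
    · rw [biproduct.ι_π_self, appL_id, ← map_smul, smul_eq_mul, mul_one] at this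
      exact (toO W).map_eq_zero_iff.1 this
    · intro i _ hij
      rw [biproduct.ι_π_ne _ hij, appL_zero, smul_zero]
    · simp
  · refine ⟨fun i => (toO W).symm (appL (biproduct.π _ i) W m), ?_⟩
    conv_rhs => rw [← appL_id m, ← biproduct.total, appL_sum]
    refine Finset.sum_congr rfl fun i _ => ?_
    rw [← map_smul, ← map_smul, smul_eq_mul, mul_one, LinearEquiv.apply_symm_apply, appL_comp]

/-- The global section `v ⊗ 1` of `V ⊗ 𝒪`. -/
def trivSec {V : ModuleCat.{0} ℂ} (v : V) : Γ((trivialBundle f).obj V, (⊤ : C.Opens)) :=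
  h0Equiv f _ ((trivialBundleAdjunction f).unit.app V v)

lemma appL_homEquiv_symm {V : ModuleCat.{0} ℂ} (g : V ⟶ (H0 f).obj M) (v : V) :
    appL (((trivialBundleAdjunction f).homEquiv _ _).symm g) ⊤ (trivSec f v) =
      h0Equiv f M (g v) := by
  have h := ((trivialBundleAdjunction f).homEquiv _ _).apply_symm_apply g
  rw [Adjunction.homEquiv_unit] at h
  conv_rhs => rw [← h]
  rfl

lemma appL_evaluation (P : Submodule ℂ ((H0 f).obj M)) (p : P) :
    appL (evaluation f P) ⊤ (trivSec f (V := ModuleCat.of ℂ P) p) = h0Equiv f M p :=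
  appL_homEquiv_symm f _ _

lemma exists_hom_of_basis {ι : Type*} {V : ModuleCat.{0} ℂ} (b : Module.Basis ι ℂ V)
    (H : ModuleCat.{0} ℂ) (t : ι → H) : ∃ g : V ⟶ H, ∀ i, g (b i) = t i :=
  ⟨ModuleCat.ofHom (b.constr ℂ t), b.constr_basis ℂ t⟩

open Limits in
-- The bundle `V ⊗ 𝒪` is an inverse image, so its sections are reached through the adjunction with
-- `H0`: a basis defines maps to and from `𝒪ⁿ`, which are mutually inverse because they match
-- generators. The standard frame of `𝒪ⁿ` is then transported.
lemma isFrame_trivSec {n : ℕ} {V : ModuleCat.{0} ℂ} (b : Module.Basis (Fin n) ℂ V) :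
    IsFrame fun i => trivSec f (b i) := by
  let O := fun _ : Fin n => structureModule C
  let A : ⨁ O ⟶ (trivialBundle f).obj V := biproduct.desc fun i => sectionHom (trivSec f (b i))
  let t (i : Fin n) : (H0 f).obj (⨁ O) := (h0Equiv f _).symm (appL (biproduct.ι O i) ⊤ (toO ⊤ 1))
  obtain ⟨g, hg⟩ := exists_hom_of_basis b ((H0 f).obj (⨁ O)) t
  let B : (trivialBundle f).obj V ⟶ ⨁ O := ((trivialBundleAdjunction f).homEquiv _ _).symm g
  have hA (i : Fin n) : appL A ⊤ (appL (biproduct.ι O i) ⊤ (toO ⊤ 1)) = trivSec f (b i) := by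
    rw [← appL_comp, biproduct.ι_desc, appL_sectionHom, one_smul, res_self]
  have hB (i : Fin n) : appL B ⊤ (trivSec f (b i)) = appL (biproduct.ι O i) ⊤ (toO ⊤ 1) := by
    rw [appL_homEquiv_symm]
    exact congrArg (h0Equiv f _) (hg i)
  have hAB : A ≫ B = 𝟙 _ := by
    refine biproduct.hom_ext' _ _ fun i => structureModule_hom_ext ?_
    rw [appL_comp, appL_comp, hA, hB, appL_comp, appL_id]
  have hBA : B ≫ A = 𝟙 _ := by
    refine ((trivialBundleAdjunction f).homEquiv _ _).injective ?_
    ext : 1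
    refine b.ext fun i => ?_
    rw [Adjunction.homEquiv_unit, Adjunction.homEquiv_unit]
    refine (h0Equiv f _).injective ?_
    change appL (B ≫ A) ⊤ (trivSec f (b i)) = trivSec f (b i)
    rw [appL_comp, hB, hA]
  have : IsIso A := ⟨B, hAB, hBA⟩
  have := (isFrame_biproduct n).appL_of_isIso A
  convert this using 2 with i
  exact (hA i).symm

lemma isVectorBundle_trivialBundle {n : ℕ} {V : ModuleCat.{0} ℂ} (b : Module.Basis (Fin n) ℂ V) :
    IsVectorBundle n ((trivialBundle f).obj V) :=
  (isVectorBundle_iff n).2 fun _ => ⟨⊤, trivial, _, isFrame_trivSec f b⟩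

end GlobalSections

/-! ### Top exterior powers of free modules. -/

lemma alternating_eq_det_smul {R A B : Type*} [CommRing R] [AddCommGroup A] [AddCommGroup B]
    [Module R A] [Module R B] {k : ℕ} (b : Module.Basis (Fin k) R A) (g : A [⋀^Fin k]→ₗ[R] B)
    (v : Fin k → A) : g v = b.det v • g b := by
  have : g = (LinearMap.toSpanSingleton R B (g b)).compAlternatingMap b.det := by
    -- Only injective families of basis vectors matter; with `k` indices these are permutations,
    -- where both sides change by the sign.
    refine b.ext_alternating fun w hw => ?_
    obtain ⟨σ, rfl⟩ : ∃ σ : Equiv.Perm (Fin k), w = σ :=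
      ⟨Equiv.ofBijective w (Finite.injective_iff_bijective.1 hw), rfl⟩
    have h1 := g.map_perm b σ
    have h2 := b.det.map_perm b σ
    simp only [LinearMap.compAlternatingMap_apply, LinearMap.toSpanSingleton_apply]
    change g (b ∘ σ) = b.det (b ∘ σ) • g b
    rw [h1, h2, b.det_self]
    simp only [Units.smul_def, smul_assoc, one_smul]
  conv_lhs => rw [this]
  rfl

/-- The coefficient of an element of the top exterior power. -/
def topCoeff {R A : Type*} [CommRing R] [AddCommGroup A] [Module R A] {k : ℕ}
    (b : Module.Basis (Fin k) R A) : ⋀[R]^k A →ₗ[R] R :=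
  exteriorPower.alternatingMapLinearEquiv b.det

lemma topCoeff_smul {R A : Type*} [CommRing R] [AddCommGroup A] [Module R A] {k : ℕ}
    (b : Module.Basis (Fin k) R A) (x : ⋀[R]^k A) :
    topCoeff b x • exteriorPower.ιMulti R k b = x := by
  refine exterior_induction (p := fun x => topCoeff b x • exteriorPower.ιMulti R k b = x) k x
    (fun v => ?_) (fun x y hx hy => ?_) fun r x hx => ?_
  · rw [topCoeff, exteriorPower.alternatingMapLinearEquiv_apply_ιMulti]
    exact (alternating_eq_det_smul b _ v).symm
  · rw [map_add, add_smul, hx, hy]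
  · rw [map_smul, smul_assoc, hx]

lemma topCoeff_self {R A : Type*} [CommRing R] [AddCommGroup A] [Module R A] {k : ℕ}
    (b : Module.Basis (Fin k) R A) : topCoeff b (exteriorPower.ιMulti R k b) = 1 := by
  rw [topCoeff, exteriorPower.alternatingMapLinearEquiv_apply_ιMulti, b.det_self]

/-! ### The determinant of a vector bundle. -/

section Wedge

variable {X : Scheme.{u}} {M N : X.Modules} {U V W : X.Opens} {k : ℕ}

/-- From exterior powers of sections to sections of the exterior power. -/
def wedgeLin (k : ℕ) (M : X.Modules) (U : X.Opens) :
    ⋀[Γ(X, U)]^k Γ(M, U) →ₗ[Γ(X, U)] Γ(wedge k M, U) where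
  toFun := shSec (exteriorPresheaf k M) U
  map_add' := map_add (shSec (exteriorPresheaf k M) U)
  map_smul' := shSec_smul (exteriorPresheaf k M)

/-- Restriction of exterior powers of sections. -/
def extRes (k : ℕ) (M : X.Modules) (h : V ≤ U) :
    ⋀[Γ(X, U)]^k Γ(M, U) →ₛₗ[resO h] ⋀[Γ(X, V)]^k Γ(M, V) where
  toFun := exteriorMap k (resO h) (res M h).toAddMonoidHom (map_smulₛₗ (res M h))
  map_add' := map_add _
  map_smul' := exteriorMap_smul k _ _ _

lemma extRes_ιMulti (h : V ≤ U) (v : Fin k → Γ(M, U)) :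
    extRes k M h (exteriorPower.ιMulti _ k v) =
      exteriorPower.ιMulti Γ(X, V) k fun i => res M h (v i) :=
  exteriorMap_ιMulti k _ _ (map_smulₛₗ (res M h)) v

lemma wedgeLin_res (h : V ≤ U) (x : ⋀[Γ(X, U)]^k Γ(M, U)) :
    wedgeLin k M V (extRes k M h x) = res (wedge k M) h (wedgeLin k M U x) :=
  shSec_res (exteriorPresheaf k M) h x

lemma wedgeLin_locInj (x : ⋀[Γ(X, U)]^k Γ(M, U)) (h : wedgeLin k M U x = 0) :
    ∀ p ∈ U, ∃ (V : X.Opens) (i : V ≤ U), p ∈ V ∧ extRes k M i x = 0 :=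
  shSec_locInj (exteriorPresheaf k M) x h

lemma wedgeLin_locSurj (y : Γ(wedge k M, U)) :
    ∀ p ∈ U, ∃ (V : X.Opens) (i : V ≤ U), p ∈ V ∧ ∃ x, wedgeLin k M V x = res _ i y :=
  shSec_locSurj (exteriorPresheaf k M) y

/-- The section `v₁ ∧ ⋯ ∧ vₖ` of the exterior power. -/
def wedgeSec (k : ℕ) (M : X.Modules) (U : X.Opens) :
    Γ(M, U) [⋀^Fin k]→ₗ[Γ(X, U)] Γ(wedge k M, U) :=
  (wedgeLin k M U).compAlternatingMap (exteriorPower.ιMulti Γ(X, U) k)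

lemma wedgeSec_apply (v : Fin k → Γ(M, U)) :
    wedgeSec k M U v = wedgeLin k M U (exteriorPower.ιMulti Γ(X, U) k v) := rfl

lemma wedgeSec_res (h : V ≤ U) (v : Fin k → Γ(M, U)) :
    res (wedge k M) h (wedgeSec k M U v) = wedgeSec k M V fun i => res M h (v i) := by
  rw [wedgeSec_apply, wedgeSec_apply, ← wedgeLin_res, extRes_ιMulti]

/-- Sections of the exterior power come only locally from exterior powers of modules, where
`topCoeff` supplies the coefficient. Independence is checked locally; it also makes the local
coefficients unique, so they agree on overlaps and glue. -/
lemma IsFrame.wedge {e : Fin k → Γ(M, U)} (he : IsFrame e) :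
    IsFrame fun _ : Fin 1 => wedgeSec k M U e := by
  have hli (W : X.Opens) (h : W ≤ U) (c : Γ(X, W))
      (hc : c • wedgeSec k M W (fun i => CurveBundle.res M h (e i)) = 0) : c = 0 := by
    refine eq_of_locallyO fun x hx => ?_
    rw [wedgeSec_apply, ← map_smul] at hc
    obtain ⟨V, i, hxV, hV⟩ := wedgeLin_locInj _ hc x hx
    refine ⟨V, i, hxV, ?_⟩
    rw [map_smulₛₗ, extRes_ιMulti] at hV
    have := congrArg (topCoeff (he.basis (i.trans h))) hV
    have hb : (fun j => CurveBundle.res M i (CurveBundle.res M h (e j))) =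
        he.basis (i.trans h) := by
      ext j; simp
    rw [hb, map_smul, topCoeff_self, map_zero, smul_eq_mul, mul_one] at this
    rw [this, map_zero]
  intro W h
  simp only [wedgeSec_res, Finset.univ_unique, Finset.sum_singleton]
  refine ⟨fun c hc i => ?_, fun m => ?_⟩
  · rw [Subsingleton.elim i default]
    exact hli W h _ hc
  · choose V hV hxV x hx using fun p : W => wedgeLin_locSurj m p.1 p.2
    have hr (p : W) : ∃ r : Γ(X, V p), r • wedgeSec k M (V p)
        (fun i => CurveBundle.res M ((hV p).trans h) (e i)) = CurveBundle.res _ (hV p) m := by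
      refine ⟨topCoeff (he.basis ((hV p).trans h)) (x p), ?_⟩
      have hb : (fun j => CurveBundle.res M ((hV p).trans h) (e j)) =
          he.basis ((hV p).trans h) := by
        ext j; simp
      rw [wedgeSec_apply, hb, ← map_smul, topCoeff_smul, hx]
    choose r hr using hr
    obtain ⟨t, ht⟩ := exists_glueO V hV hxV r fun p q => by
      rw [← sub_eq_zero]
      refine hli _ ((inf_le_left.trans (hV p)).trans h) _ ?_
      have h1 := congrArg (CurveBundle.res _ (inf_le_left : V p ⊓ V q ≤ V p)) (hr p)
      have h2 := congrArg (CurveBundle.res _ (inf_le_right : V p ⊓ V q ≤ V q)) (hr q)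
      simp only [map_smulₛₗ, wedgeSec_res, res_res] at h1 h2
      rw [sub_smul, h1, h2, sub_self]
    refine ⟨fun _ => t, eq_of_locally fun p hp => ⟨V ⟨p, hp⟩, hV _, hxV ⟨p, hp⟩, ?_⟩⟩
    rw [map_smulₛₗ, wedgeSec_res, ht, ← hr]
    simp only [res_res]

lemma update_fin_one {α : Type*} (v : Fin 1 → α) (x : α) :
    Function.update v 0 x = fun _ => x := by
  ext i
  rw [Subsingleton.elim i 0, Function.update_self]

/-- The morphism from a sheaf of modules to its first exterior power. -/
def toWedgeOne (L : X.Modules) : L ⟶ wedge 1 L :=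
  homOfLinear (fun U =>
    { toFun := fun m => wedgeSec 1 L U fun _ => m
      map_add' := fun m n => by
        have h := (wedgeSec 1 L U).map_update_add (fun _ => m) 0 m n
        rwa [update_fin_one, update_fin_one, update_fin_one] at h
      map_smul' := fun r m => by
        have h := (wedgeSec 1 L U).map_update_smul (fun _ => m) 0 r m
        rwa [update_fin_one, update_fin_one] at h })
    fun U V h m => (wedgeSec_res h _).symm

/-- Converts equality of first Chern classes into an isomorphism of `det M` with `L` itself. -/
lemma isIso_toWedgeOne {L : X.Modules} (hL : IsVectorBundle 1 L) : IsIso (toWedgeOne L) := by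
  rw [isVectorBundle_iff] at hL
  refine isIso_of_isFrame _ fun x => ?_
  obtain ⟨U, hU, e, he⟩ := hL x
  refine ⟨U, hU, 1, e, he, ?_⟩
  convert he.wedge using 2 with i
  change wedgeSec 1 L U _ = _
  congr 1
  ext j
  rw [Subsingleton.elim i j]

end Wedge

/-! ### Cramer's rule for `k + 1` vectors in rank `k`. -/

section Minors

variable {R A : Type*} [CommRing R] [AddCommGroup A] [Module R A] {k : ℕ}
  (b : Module.Basis (Fin k) R A) (s : Fin (k + 1) → A)

/-- The signed maximal minors of the coordinates of `k + 1` vectors in a free module of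
rank `k`. -/
def minor (i : Fin (k + 1)) : R := (-1) ^ (i : ℕ) * b.det fun j => s (i.succAbove j)

/-- The coordinate matrix of `s`, with `v` as an additional first row. -/
def augmented (v : Fin (k + 1) → R) : Matrix (Fin (k + 1)) (Fin (k + 1)) R :=
  Matrix.of (Fin.cons v fun a i => b.repr (s i) a)

/-- Laplace expansion along the added row: pairing with the minors becomes a determinant. -/
lemma det_augmented (v : Fin (k + 1) → R) :
    (augmented b s v).det = ∑ i, v i * minor b s i := by
  rw [Matrix.det_succ_row_zero]
  refine Finset.sum_congr rfl fun i _ => ?_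
  rw [minor, Module.Basis.det_apply]
  have h : (augmented b s v).submatrix Fin.succ i.succAbove =
      b.toMatrix fun j => s (i.succAbove j) := by
    ext a j
    simp [augmented, Module.Basis.toMatrix_apply]
  rw [h]
  simp only [augmented, Matrix.of_apply, Fin.cons_zero]
  ring

/-- Each coordinate of the sum is the determinant of a matrix with a repeated row. -/
lemma sum_minor_smul : ∑ i, minor b s i • s i = 0 := by
  refine b.ext_elem fun a => ?_
  have h : (augmented b s fun i => b.repr (s i) a).det = 0 :=
    Matrix.det_zero_of_row_eq (Fin.succ_ne_zero a) (by ext i; simp [augmented])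
  rw [det_augmented] at h
  simpa [mul_comm] using h

/-- Expanding `b.det b = 1` multilinearly in the `s i` writes `1` as a combination of determinants
of `k`-tuples of the `s i`; each of these is zero or a minor up to sign. -/
lemma exists_sum_mul_minor (hs : ∀ a, ∃ c : Fin (k + 1) → R, ∑ i, c i • s i = b a) :
    ∃ l : Fin (k + 1) → R, ∑ i, l i * minor b s i = 1 := by
  choose c hc using hs
  have hw (i : Fin (k + 1)) : minor b s i ∈ Ideal.span (Set.range (minor b s)) :=
    Ideal.subset_span ⟨i, rfl⟩
  have hmem (φ : Fin k → Fin (k + 1)) :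
      b.det (fun a => s (φ a)) ∈ Ideal.span (Set.range (minor b s)) := by
    -- By counting, `k` indices miss one of the `k + 1` values, so `φ` factors through
    -- `i.succAbove`.
    obtain ⟨i, hi⟩ : ∃ i, ∀ a, φ a ≠ i := by
      by_contra! h
      have := Fintype.card_le_of_surjective φ h
      simp at this
    choose g hg using fun a => Fin.exists_succAbove_eq (hi a)
    by_cases hinj : Function.Injective g
    · let σ : Equiv.Perm (Fin k) := Equiv.ofBijective g (Finite.injective_iff_bijective.1 hinj)
      have h1 := b.det.map_perm (fun j => s (i.succAbove j)) σ
      have h2 : (fun j => s (i.succAbove j)) ∘ σ = fun a => s (φ a) := by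
        ext a; simp [σ, hg]
      rw [← h2, h1]
      have h3 : b.det (fun j => s (i.succAbove j)) = (-1) ^ (i : ℕ) * minor b s i := by
        rw [minor, ← mul_assoc, ← pow_add, Even.neg_one_pow ⟨_, rfl⟩, one_mul]
      rw [h3, Units.smul_def, zsmul_eq_mul, ← mul_assoc]
      exact Ideal.mul_mem_left _ _ (hw i)
    · obtain ⟨a, a', h, hne⟩ : ∃ a a', g a = g a' ∧ a ≠ a' := by
        simpa [Function.Injective] using hinj
      rw [b.det.map_eq_zero_of_eq _ (by rw [← hg a, ← hg a', h]) hne]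
      exact zero_mem _
  have h1 : (1 : R) ∈ Ideal.span (Set.range (minor b s)) := by
    have h0 : b.det (fun a => ∑ i, c a i • s i) = 1 := by
      rw [funext hc, b.det_self]
    rw [← h0]
    have h2 := b.det.toMultilinearMap.map_sum fun a i => c a i • s i
    simp only [AlternatingMap.coe_multilinearMap, MultilinearMap.map_smul_univ] at h2
    rw [h2]
    refine sum_mem fun φ _ => ?_
    exact Ideal.mul_mem_left _ _ (hmem φ)
  exact (Ideal.mem_span_range_iff_exists_fun).1 h1

/-- Adding the row `l` makes the coordinate matrix invertible, of determinant `1`. It sends a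
relation `c` to the vector `(∑ l j * c j, 0, …, 0)`, and the minors to `(1, 0, …, 0)`, so
injectivity forces proportionality. -/
lemma eq_smul_minor {l c : Fin (k + 1) → R} (hl : ∑ i, l i * minor b s i = 1)
    (hc : ∑ i, c i • s i = 0) (i : Fin (k + 1)) : c i = (∑ j, l j * c j) * minor b s i := by
  have hN : IsUnit (augmented b s l).det := by rw [det_augmented, hl]; exact isUnit_one
  have hmul (d : Fin (k + 1) → R) (hd : ∑ i, d i • s i = 0) :
      (augmented b s l).mulVec d = Fin.cons (∑ j, l j * d j) 0 := by
    ext a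
    refine Fin.cases ?_ (fun a => ?_) a
    · simp [Matrix.mulVec, dotProduct, augmented]
    · have := congrArg (fun x => b.repr x a) hd
      simpa [Matrix.mulVec, dotProduct, augmented, mul_comm] using this
  have h : (augmented b s l).mulVec c =
      (augmented b s l).mulVec ((∑ j, l j * c j) • minor b s) := by
    rw [Matrix.mulVec_smul, hmul c hc, hmul _ (sum_minor_smul b s), hl]
    ext a
    refine Fin.cases ?_ (fun a => ?_) a <;> simp
  have hinj := Matrix.mulVec_injective_of_isUnit ((Matrix.isUnit_iff_isUnit_det _).2 hN)
  exact congrFun (hinj h) i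

end Minors

/-! ### The resolution of a bundle of rank `k` by `k + 1` generating sections. -/

section Koszul

variable {X : Scheme.{u}} {L M T : X.Modules} {U V W : X.Opens} {k : ℕ}

lemma exact_of_locally (S : ShortComplex X.Modules)
    (h : ∀ (U : X.Opens) (y : Γ(S.X₂, U)), appL S.g U y = 0 → ∀ x ∈ U,
      ∃ (V : X.Opens) (i : V ≤ U), x ∈ V ∧ ∃ z, appL S.f V z = res S.X₂ i y) : S.Exact := by
  rw [S.exact_iff_epi_kernel_lift]
  refine LocSurj.epi fun U y x hx => ?_
  obtain ⟨V, i, hxV, z, hz⟩ := h U (appL (Limits.kernel.ι S.g) U y)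
    (by rw [← appL_comp, Limits.kernel.condition, appL_zero]) x hx
  refine ⟨V, i, hxV, z, injective_of_mono (Limits.kernel.ι S.g) V ?_⟩
  rw [← appL_comp, Limits.kernel.lift_ι, hz, appL_res]

variable (ψ : ∀ U : X.Opens, Γ(M, U) [⋀^Fin k]→ₗ[Γ(X, U)] Γ(L, U))
  (hψ : ∀ (U V : X.Opens) (h : V ≤ U) (v : Fin k → Γ(M, U)),
    res L h (ψ U v) = ψ V fun i => res M h (v i))
  (s : Fin (k + 1) → Γ(M, (⊤ : X.Opens))) (t : Fin (k + 1) → Γ(T, (⊤ : X.Opens)))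

/-- The coefficients of the Koszul map. -/
def koszulCoeff (U : X.Opens) (i : Fin (k + 1)) : Γ(dual L, U) →ₗ[Γ(X, U)] Γ(X, U) where
  toFun φ := (-1) ^ (i : ℕ) * dualApp φ le_rfl (ψ U fun j => res M le_top (s (i.succAbove j)))
  map_add' φ φ' := by rw [dualApp_add, mul_add]
  map_smul' r φ := by rw [dualApp_smul, resO_self, RingHom.id_apply, smul_eq_mul]; ring

/-- An alternating map on a free module of rank `k` is a determinant times its value on a basis.
Locally the Koszul map is thus one scalar times the vector of minors, although its definition uses
no frame. -/
lemma koszulCoeff_eq {e : Fin k → Γ(M, U)} (he : IsFrame e) (φ : Γ(dual L, U))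
    (i : Fin (k + 1)) : koszulCoeff ψ s U i φ =
      dualApp φ le_rfl (ψ U e) * minor (he.basis le_rfl) (fun i => res M le_top (s i)) i := by
  have hb : (he.basis le_rfl : Fin k → _) = e := by ext i; simp
  change (-1) ^ (i : ℕ) * dualApp φ le_rfl (ψ U _) = _
  rw [alternating_eq_det_smul (he.basis le_rfl) (ψ U), hb, map_smul, minor, smul_eq_mul]
  ring

include hψ in
lemma koszulCoeff_res (h : V ≤ U) (φ : Γ(dual L, U)) (i : Fin (k + 1)) :
    koszulCoeff ψ s V i (res _ h φ) = resO h (koszulCoeff ψ s U i φ) := by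
  change (-1) ^ (i : ℕ) * _ = resO h ((-1) ^ (i : ℕ) * _)
  rw [map_mul, map_pow, map_neg, map_one, dualApp_res, ← dualApp_res_right, hψ]
  simp only [res_res]

/-- The Koszul map `L^* → T` attached to sections `s` of `M`, an alternating map `Mᵏ → L` and
global sections `t` of `T`. -/
def koszul : dual L ⟶ T :=
  homOfLinear (fun U => ∑ i, (koszulCoeff ψ s U i).smulRight (res T le_top (t i)))
    fun U V h φ => by
      simp only [LinearMap.sum_apply, LinearMap.smulRight_apply, map_sum, map_smulₛₗ, res_res,
        koszulCoeff_res ψ hψ]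

lemma appL_koszul (φ : Γ(dual L, U)) : appL (koszul ψ hψ s t) U φ =
    ∑ i, koszulCoeff ψ s U i φ • res T le_top (t i) := by
  simp [koszul]

variable {s t}

/-- If `M` is locally free of rank `k`, `T` is free on `t` and `T → M` is an epimorphism carrying
`t` to `s`, then `0 → L^* → T → M → 0` is exact. -/
theorem koszul_shortExact (hM : IsVectorBundle k M)
    (hψf : ∀ (U : X.Opens) (e : Fin k → Γ(M, U)), IsFrame e → IsFrame fun _ : Fin 1 => ψ U e)
    (ht : IsFrame t) (ev : T ⟶ M) [Epi ev] (hev : ∀ i, appL ev ⊤ (t i) = s i) :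
    ∃ h : koszul ψ hψ s t ≫ ev = 0, (ShortComplex.mk _ ev h).ShortExact := by
  have hevU (U : X.Opens) (c : Fin (k + 1) → Γ(X, U)) :
      appL ev U (∑ i, c i • res T le_top (t i)) = ∑ i, c i • res M le_top (s i) := by
    simp only [map_sum, map_smul, appL_res, hev]
  -- Lifting a frame of `M` to `T` and expanding in `t` expresses that frame through the `s i`.
  have hloc (x : X) : ∃ (V : X.Opens) (_ : x ∈ V) (e : Fin k → Γ(M, V)) (_ : IsFrame e),
      ∀ a, ∃ c : Fin (k + 1) → Γ(X, V), ∑ i, c i • res M le_top (s i) = e a := by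
    rw [isVectorBundle_iff] at hM
    obtain ⟨U, hU, e, he⟩ := hM x
    obtain ⟨V, hV, hxV, z, hz⟩ := (locSurj_of_epi ev).exists_lift e hU
    refine ⟨V, hxV, _, he.res hV, fun a => ?_⟩
    obtain ⟨c, hc⟩ := (ht V le_top).2 (z a)
    exact ⟨c, by rw [← hevU, hc, hz]⟩
  have hfr (U : X.Opens) (x : X) (hx : x ∈ U) :
      ∃ (V : X.Opens) (_ : V ≤ U) (_ : x ∈ V) (e : Fin k → Γ(M, V)) (he : IsFrame e)
        (l : Fin (k + 1) → Γ(X, V)),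
        ∑ i, l i * minor (he.basis le_rfl) (fun i => res M le_top (s i)) i = 1 := by
    obtain ⟨V, hxV, e, he, hc⟩ := hloc x
    refine ⟨U ⊓ V, inf_le_left, ⟨hx, hxV⟩, _, he.res inf_le_right, ?_⟩
    refine exists_sum_mul_minor _ _ fun a => ?_
    obtain ⟨c, hc⟩ := hc a
    refine ⟨fun i => resO inf_le_right (c i), ?_⟩
    rw [IsFrame.basis_apply, res_self, ← hc]
    simp only [map_sum, map_smulₛₗ, res_res]
  have hzero : koszul ψ hψ s t ≫ ev = 0 := by
    refine hom_ext_appL fun U φ => eq_of_locally fun x hx => ?_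
    obtain ⟨V, hV, hxV, e, he, -⟩ := hfr U x hx
    refine ⟨V, hV, hxV, ?_⟩
    rw [← appL_res, appL_comp, appL_koszul, hevU]
    simp only [koszulCoeff_eq ψ s he, mul_smul, ← Finset.smul_sum]
    rw [sum_minor_smul, smul_zero, appL_zero, map_zero]
  have hmono : Mono (koszul ψ hψ s t) := by
    refine mono_of_injective _ fun U φ hφ => eq_of_locally fun x hx => ?_
    obtain ⟨V, hV, hxV, e, he, l, hl⟩ := hfr U x hx
    refine ⟨V, hV, hxV, ?_⟩
    have h0 := congrArg (res T hV) hφ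
    rw [← appL_res, appL_koszul, map_zero] at h0
    have h1 := (ht V le_top).1 _ h0
    simp only [koszulCoeff_eq ψ s he] at h1
    refine (hψf V e he).dual_ext fun _ => ?_
    rw [map_zero, dualApp_zero]
    -- All products of this scalar with the minors vanish, and the minors generate the unit ideal.
    calc dualApp (res (dual L) hV φ) le_rfl (ψ V e)
        = ∑ i, l i * (dualApp (res (dual L) hV φ) le_rfl (ψ V e) *
            minor (he.basis le_rfl) (fun i => res M le_top (s i)) i) := by
          simp only [mul_left_comm (l _), ← Finset.mul_sum, hl, mul_one]
      _ = 0 := by simp only [h1, mul_zero, Finset.sum_const_zero]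
  refine ⟨hzero, ?_⟩
  have hexact : (ShortComplex.mk _ ev hzero).Exact := by
    refine exact_of_locally _ fun U y hy x hx => ?_
    obtain ⟨V, hV, hxV, e, he, l, hl⟩ := hfr U x hx
    refine ⟨V, hV, hxV, ?_⟩
    obtain ⟨c, hc⟩ := (ht V le_top).2 (res T hV y)
    have hc0 : ∑ i, c i • res M (le_top : V ≤ ⊤) (s i) = 0 := by
      rw [← hevU, hc, appL_res]
      exact (congrArg _ hy).trans (map_zero _)
    -- The form on `L` whose value on the frame `ψ V e` is the proportionality factor of
    -- `eq_smul_minor`.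
    let φ : Γ(dual L, V) := (∑ j, l j * c j) • (hψf V e he).dualSec 0
    refine ⟨φ, ?_⟩
    have hφ : dualApp φ le_rfl (ψ V e) = ∑ j, l j * c j := by
      have := (hψf V e he).dualApp_dualSec_self 0 0 le_rfl
      rw [res_self, if_pos rfl] at this
      rw [dualApp_smul, resO_self, this, mul_one]
    change appL (koszul ψ hψ s t) V φ = _
    rw [appL_koszul]
    refine Eq.trans (Finset.sum_congr rfl fun i _ => ?_) hc
    rw [koszulCoeff_eq ψ s he, hφ, ← eq_smul_minor _ _ hl hc0]
  exact { exact := hexact, mono_f := hmono, epi_g := inferInstanceAs (Epi ev) }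

end Koszul

/-! ### Comparison of the two kernels. -/

section Diagram

variable {X : Scheme.{u}}

/-- If `B → M` is an epimorphism on the kernel `A` of a split epimorphism `B → D`, with kernel `N`
on `A` and `K` on `B`, then `0 → N → K → D → 0` is exact. -/
lemma exists_kernel_shortExact {N A B D K M : X.Modules} {m : A ⟶ B} {q : B ⟶ D} {hmq : m ≫ q = 0}
    (hs : (ShortComplex.mk m q hmq).Splitting) {e : B ⟶ M} [Epi (m ≫ e)]
    {κ : N ⟶ A} {hκ : κ ≫ m ≫ e = 0} (hN : (ShortComplex.mk κ (m ≫ e) hκ).ShortExact)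
    {j : K ⟶ B} {hj : j ≫ e = 0} (hK : (ShortComplex.mk j e hj).ShortExact) :
    ∃ (i : N ⟶ K) (h : i ≫ j ≫ q = 0), (ShortComplex.mk i (j ≫ q) h).ShortExact := by
  have : Mono j := hK.mono_f
  have : Mono κ := hN.mono_f
  have : Mono m := hs.shortExact.mono_f
  obtain ⟨i, hi⟩ : ∃ i : N ⟶ K, i ≫ j = κ ≫ m :=
    ⟨hK.exact.lift (κ ≫ m) (by simpa using hκ), hK.exact.lift_f _ _⟩
  have h0 : i ≫ j ≫ q = 0 := by
    rw [← Category.assoc, hi, Category.assoc, hmq, Limits.comp_zero]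
  have hmono : Mono i := by
    have : Mono (i ≫ j) := by rw [hi]; infer_instance
    exact mono_of_mono i j
  -- Lift `v` to `B` by the splitting. Since `A` already maps onto `M`, subtracting a local section
  -- of `A` moves the lift into `K` without changing its image in `D`.
  have hepi : Epi (j ≫ q) := LocSurj.epi fun U v x hx => by
    obtain ⟨V, hV, hxV, a, ha⟩ := locSurj_of_epi (m ≫ e) U (appL e U (appL hs.s U v)) x hx
    obtain ⟨y, hy⟩ := exact_sections _ hK.exact V (appL hs.s V (res D hV v) - appL m V a) (by
      change appL e V _ = 0
      rw [map_sub, ← appL_comp m e, ha, appL_res, appL_res, sub_self])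
    refine ⟨V, hV, hxV, y, ?_⟩
    change appL j V y = _ at hy
    have h1 : appL q V (appL hs.s V (res D hV v)) = res D hV v := by
      rw [← appL_comp]
      exact congrArg (fun φ : D ⟶ D => appL φ V (res D hV v)) hs.s_g
    have h2 : appL q V (appL m V a) = 0 := by rw [← appL_comp, hmq, appL_zero]
    rw [appL_comp, hy, map_sub, h1, h2, sub_zero]
  refine ⟨i, h0, { exact := ?_, mono_f := hmono, epi_g := hepi }⟩
  refine exact_of_locally _ fun U y hy x hx => ⟨U, le_rfl, hx, ?_⟩
  -- A section of `K` that dies in `D` comes from `A`; it still dies in `M`, so it comes from `N`.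
  obtain ⟨a, ha⟩ := exact_sections _ hs.shortExact.exact U (appL j U y) hy
  change appL m U a = _ at ha
  obtain ⟨n, hn⟩ := exact_sections _ hN.exact U a (by
    change appL e U (appL m U a) = 0
    rw [ha, ← appL_comp, hj, appL_zero])
  refine ⟨n, injective_of_mono j U ?_⟩
  change appL κ U n = a at hn
  change appL (i ≫ j) U n = _
  rw [hi, appL_comp, hn, ha, res_self]

/-! ### Global sections of duals -/

/-- The linear form on `M` given by a global section of `M^*`. -/
def dualHom {M : X.Modules} (φ : Γ(dual M, (⊤ : X.Opens))) : M ⟶ structureModule X :=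
  homOfLinear (fun U => (toO U).toLinearMap.comp (dualApp φ le_top)) fun U V h m => by
    simp only [LinearMap.comp_apply, LinearEquiv.coe_coe, res_toO,
      ← dualApp_res_right φ le_top h m]

lemma exists_dualHom {M : X.Modules} (g : M ⟶ structureModule X) :
    ∃ φ : Γ(dual M, (⊤ : X.Opens)), dualHom φ = g :=
  ⟨dualMk (fun W _ => (toO W).symm.toLinearMap.comp (appL g W)) fun W V _ h' m => by
    simp only [LinearMap.comp_apply, LinearEquiv.coe_coe, appL_res, resO_toO_symm], rfl⟩

/-- Restriction of linear forms along a morphism. -/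
def dualPull {M N : X.Modules} (j : N ⟶ M) (U : X.Opens) :
    Γ(dual M, U) →ₗ[Γ(X, U)] Γ(dual N, U) where
  toFun φ := dualMk (fun W h => (dualApp φ h).comp (appL j W)) fun W V h h' m => by
    simp only [LinearMap.comp_apply, appL_res, dualApp_res_right φ h h']
  map_add' _ _ := rfl
  map_smul' _ _ := rfl

lemma dualHom_dualPull {M N : X.Modules} (j : N ⟶ M) (φ : Γ(dual M, (⊤ : X.Opens))) :
    dualHom (dualPull j ⊤ φ) = j ≫ dualHom φ := rfl

lemma dualHom_zero (M : X.Modules) : dualHom (0 : Γ(dual M, (⊤ : X.Opens))) = 0 := rfl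

/-- A form on `B` that vanishes on `K` descends to the quotient `M`, which has no nonzero global
form. -/
lemma dualPull_injective {K B M : X.Modules} {j : K ⟶ B} {e : B ⟶ M} {h : j ≫ e = 0}
    (hK : (ShortComplex.mk j e h).ShortExact) (hM : ∀ φ : Γ(dual M, (⊤ : X.Opens)), φ = 0)
    {φ : Γ(dual B, (⊤ : X.Opens))} (hφ : dualPull j ⊤ φ = 0) : φ = 0 := by
  have : Epi e := hK.epi_g
  have h0 : j ≫ dualHom φ = 0 := by rw [← dualHom_dualPull, hφ, dualHom_zero]
  obtain ⟨g, hg⟩ : ∃ g, e ≫ g = dualHom φ := ⟨hK.exact.desc _ h0, hK.exact.g_desc _ _⟩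
  obtain ⟨η, rfl⟩ := exists_dualHom g
  rw [hM η, dualHom_zero, Limits.comp_zero] at hg
  refine dual_ext fun W i m => (toO W).injective ?_
  have := congrArg (fun ψ => appL ψ W m) hg
  exact this.symm

end Diagram

/-! ### Global sections of the dual kernel, and the splitting of `P` along `S`. -/

section Curve

variable {C : Scheme.{0}} (f : C ⟶ Spec (.of ℂ))

/-- The witnesses are the restrictions to `K` of the coordinate forms of `V ⊗ 𝒪`. -/
lemma rank_H0_dual_ge [Nonempty C] {n : ℕ} {V : ModuleCat.{0} ℂ} (b : Module.Basis (Fin n) ℂ V)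
    {K M : C.Modules} {j : K ⟶ (trivialBundle f).obj V} {e : (trivialBundle f).obj V ⟶ M}
    {h : j ≫ e = 0} (hK : (ShortComplex.mk j e h).ShortExact)
    (hM : Module.rank ℂ ((H0 f).obj (dual M)) = 0) :
    (n : Cardinal) ≤ Module.rank ℂ ((H0 f).obj (dual K)) := by
  have hM0 (φ : Γ(dual M, (⊤ : C.Opens))) : φ = 0 :=
    (h0Equiv f (dual M)).symm.injective ((rank_zero_iff.1 hM).elim _ _)
  have ht := isFrame_trivSec f b
  let x (i : Fin n) : (H0 f).obj (dual K) := (h0Equiv f _).symm (dualPull j ⊤ (ht.dualSec i))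
  have hx : LinearIndependent ℂ x := by
    refine Fintype.linearIndependent_iff.2 fun c hc i => ?_
    have h1 := congrArg (h0Equiv f (dual K)) hc
    simp only [map_sum, h0Equiv_smul, map_zero, x, AddEquiv.apply_symm_apply] at h1
    simp only [← map_smul, ← map_sum] at h1
    have h2 := (ht.dual ⊤ le_rfl).1 (fun i => scalar f (c i)) (by
      simpa only [res_self] using dualPull_injective hK hM0 h1) i
    -- Nonemptiness makes the ring of global functions nontrivial, so `scalar f` is injective on the
    -- field `ℂ`.
    have : Nonempty (⊤ : C.Opens) := ⟨⟨Classical.arbitrary C, trivial⟩⟩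
    exact (map_eq_zero (scalar f)).1 h2
  simpa using hx.cardinal_le_rank

/-- A left adjoint preserves binary coproducts, hence biproducts. Additivity is what carries a
splitting of vector spaces to one of trivial bundles. -/
instance : (trivialBundle f).Additive :=
  have := (trivialBundleAdjunction f).isLeftAdjoint
  have := Limits.preservesBinaryBiproducts_of_preservesBinaryCoproducts (trivialBundle f)
  Functor.additive_of_preservesBinaryBiproducts _

lemma map_inclusion_evaluation {M : C.Modules} {P S : Submodule ℂ ((H0 f).obj M)} (h : S ≤ P) :
    (trivialBundle f).map (ModuleCat.ofHom (Submodule.inclusion h)) ≫ evaluation f P =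
      evaluation f S :=
  ((trivialBundleAdjunction f).homEquiv_naturality_left_symm _ _).symm

/-- The sequence `S → P → P / S` of vector spaces. -/
def quotientComplex {H : ModuleCat.{0} ℂ} {P S : Submodule ℂ H} (h : S ≤ P) :
    ShortComplex (ModuleCat.{0} ℂ) :=
  ShortComplex.mk (ModuleCat.ofHom (Submodule.inclusion h))
    (ModuleCat.ofHom (S.submoduleOf P).mkQ) (by
      ext x
      exact (Submodule.Quotient.mk_eq_zero _).2 x.2)

lemma nonempty_splitting_quotientComplex {H : ModuleCat.{0} ℂ} {P S : Submodule ℂ H} (h : S ≤ P) :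
    Nonempty (quotientComplex h).Splitting := by
  obtain ⟨σ, hσ⟩ := (S.submoduleOf P).mkQ.exists_rightInverse_of_surjective
    (Submodule.range_mkQ _)
  have hmono : Mono (quotientComplex h).f :=
    (ModuleCat.mono_iff_injective _).2 (Submodule.inclusion_injective h)
  have hex : (quotientComplex h).Exact := by
    refine (ShortComplex.moduleCat_exact_iff _).2 fun x hx => ?_
    exact ⟨⟨x.1, (Submodule.Quotient.mk_eq_zero (S.submoduleOf P)).1 hx⟩, rfl⟩
  exact ⟨ShortComplex.Splitting.ofExactOfSection _ hex (ModuleCat.ofHom σ)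
    (by ext x; exact LinearMap.congr_fun hσ x) hmono⟩

end Curve

end CurveBundle

end

/-! ### The main theorem. -/

open CurveBundle in
theorem mainTheorem6
    {C : Scheme.{0}} (f : C ⟶ Spec (.of ℂ)) (hC : CurveBundle.IsCurve f)
    (L : C.Modules) (hL : CurveBundle.IsVectorBundle 1 L)
    (k : ℕ) (M : C.Modules) (hM : CurveBundle.IsVectorBundle k M)
    (hc : CurveBundle.firstChernClass k M = CurveBundle.firstChernClass 1 L)
    (hM0 : Module.rank ℂ ((CurveBundle.H0 f).obj (CurveBundle.dual M)) = 0)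
    (P S : Submodule ℂ ((CurveBundle.H0 f).obj M))
    (hP : Module.finrank ℂ P = 2 * k + 1) (hPgen : CurveBundle.Generates f P)
    (hSP : S ≤ P)
    (hS : Module.finrank ℂ S = k + 1) (hSgen : CurveBundle.Generates f S) :
    ∃ E : C.Modules, CurveBundle.IsVectorBundle (k + 1) E ∧
      ((2 * k + 1 : ℕ) : Cardinal) ≤ Module.rank ℂ ((CurveBundle.H0 f).obj E) ∧
      ∃ (i : CurveBundle.dual L ⟶ CurveBundle.dual E)
        (p : CurveBundle.dual E ⟶
          (CurveBundle.trivialBundle f).obj (ModuleCat.of ℂ (P ⧸ S.submoduleOf P)))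
        (hip : i ≫ p = 0),
        (ShortComplex.mk i p hip).ShortExact ∧
        ∃ (j : CurveBundle.dual E ⟶ (CurveBundle.trivialBundle f).obj (ModuleCat.of ℂ P))
          (hj : j ≫ CurveBundle.evaluation f P = 0),
          (ShortComplex.mk j (CurveBundle.evaluation f P) hj).ShortExact ∧
          j ≫ (CurveBundle.trivialBundle f).map (ModuleCat.ofHom (S.submoduleOf P).mkQ) = p := by
  have : Nonempty C := hC.connected.toNonempty
  have : Epi (evaluation f P) := hPgen
  have hSgen' : Epi (evaluation f S) := hSgen
  have : Module.Finite ℂ P := Module.finite_of_finrank_pos (by omega)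
  have : Module.Finite ℂ S := Module.finite_of_finrank_pos (by omega)
  let bP := Module.finBasisOfFinrankEq ℂ P hP
  let bS := Module.finBasisOfFinrankEq ℂ S hS
  have hQ : Module.finrank ℂ (P ⧸ S.submoduleOf P) = k := by
    have h1 := Submodule.finrank_quotient_add_finrank (S.submoduleOf P)
    have h2 := (Submodule.submoduleOfEquivOfLe hSP).finrank_eq
    omega
  let bQ := Module.finBasisOfFinrankEq ℂ (P ⧸ S.submoduleOf P) hQ
  -- the Koszul resolution of `M` by `S ⊗ 𝒪`
  obtain ⟨α⟩ : Nonempty (wedge k M ≅ wedge 1 L) := Quotient.exact hc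
  have := isIso_toWedgeOne hL
  -- The isomorphism `det M ≃ L`; after the wedge product it is the alternating map `Mᵏ → L` behind
  -- the minors.
  let β : wedge k M ⟶ L := α.hom ≫ inv (toWedgeOne L)
  obtain ⟨hκ, hN⟩ := koszul_shortExact
    (fun U => (appL β U).compAlternatingMap (wedgeSec k M U))
    (fun U V h v => by
      simp only [LinearMap.compAlternatingMap_apply, ← appL_res, wedgeSec_res]) hM
    (fun U e he => he.wedge.appL_of_isIso β)
    (isFrame_trivSec f (V := ModuleCat.of ℂ S) bS) (evaluation f S)
    (fun i => appL_evaluation f S (bS i))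
  -- comparison of `S` and `P`
  obtain ⟨sp⟩ := nonempty_splitting_quotientComplex hSP
  have sp' := sp.map (trivialBundle f)
  have hSP' := map_inclusion_evaluation f hSP
  -- Stated for any model of the kernel because it serves twice: for the kernel itself, to see that
  -- it is a bundle, and then for its double dual.
  have hdiag {K : C.Modules} {j : K ⟶ (trivialBundle f).obj (ModuleCat.of ℂ P)}
      {hj : j ≫ evaluation f P = 0} (hK : (ShortComplex.mk j (evaluation f P) hj).ShortExact) :
      ∃ (i : dual L ⟶ K)
        (h : i ≫ j ≫ (trivialBundle f).map (ModuleCat.ofHom (S.submoduleOf P).mkQ) = 0),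
        (ShortComplex.mk i _ h).ShortExact := by
    simp only [← hSP'] at hSgen' hN hκ
    have : Epi ((trivialBundle f).map (quotientComplex hSP).f ≫ evaluation f P) := hSgen'
    exact exists_kernel_shortExact sp' hN hK
  have hK : (ShortComplex.mk (Limits.kernel.ι (evaluation f P)) (evaluation f P)
      (Limits.kernel.condition _)).ShortExact :=
    { exact := ShortComplex.exact_kernel _
      mono_f := inferInstance
      epi_g := hPgen }
  obtain ⟨i, hi, hiK⟩ := hdiag hK
  have hKv : IsVectorBundle (k + 1) (Limits.kernel (evaluation f P)) := by
    -- The extension has sub of rank `1` and quotient of rank `k`, which gives `1 + k`.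
    rw [add_comm]
    exact IsVectorBundle.extension _ hiK hL.dual (isVectorBundle_trivialBundle f bQ)
  have := hKv.isIso_toDoubleDual
  let θ := asIso (toDoubleDual (Limits.kernel (evaluation f P)))
  -- With `E` the dual of the kernel, `dual E` is the double dual, so the kernel sequence is
  -- transported along `θ`.
  have hj : (θ.inv ≫ Limits.kernel.ι (evaluation f P)) ≫ evaluation f P = 0 := by
    rw [Category.assoc, Limits.kernel.condition, Limits.comp_zero]
  have hK' : (ShortComplex.mk _ _ hj).ShortExact :=
    ShortComplex.shortExact_of_iso (ShortComplex.isoMk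
      (S₁ := ShortComplex.mk _ _ (Limits.kernel.condition (evaluation f P)))
      (S₂ := ShortComplex.mk _ _ hj) θ (Iso.refl _) (Iso.refl _) (by simp) (by simp)) hK
  obtain ⟨i', hi', hiK'⟩ := hdiag hK'
  exact ⟨dual (Limits.kernel (evaluation f P)), hKv.dual,
    rank_H0_dual_ge f (V := ModuleCat.of ℂ P) bP hK hM0, i', _, hi', hiK', _, hj, hK', rfl⟩
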